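/- Let $(E,\mathscr{E})$ be a measurable space, $\pi$ a Markov kernel on $E$ and $m$ a $\pi$-invariant probability measure on $E$. Let $\nu$ be the corresponding Markov measure on $\Omega = E^{\mathbb{N}_0}$, i.e. the unique probability measure with $$\nu(B_0\times\cdots\times B_{k-1}\times\Omega)=\int_{B_0}\int_{B_1}\cdots\int_{B_{k-1}}\pi(y_{k-2},dy_{k-1})\cdots\pi(y_0,dy_1)\,m(dy_0)$$ for all $k\ge 1$ and $B_0,\dots,B_{k-1}\in\mathscr{E}$. Let $(X,\mathscr{A},\mu)$ be a probability space and $(T_y)_{y\in E}$ a family of $\mu$-preserving maps $T_y\colon X\to X$ such that $(y,x)\mapsto T_y(x)$ is $\mathscr{E}\otimes\mathscr{A}$-measurable. For $\omega\in\Omega$ put $T_\omega^0=\mathrm{id}$ and $T_\omega^{n}=T_{\omega_{n-1}}\circ\cdots\circ T_{\omega_0}$ for $n\ge1$. Call $\pi$ *strictly irreducible* with respect to $m$ if $m(B)\in\{0,1\}$ for every $B\in\mathscr{E}$ such that $\pi(y,B)\in\{0,1\}$ for $m$-almost all $y\in E$. Let $\Sigma$ be the $\sigma$-algebra of all $A\in\mathscr{A}$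 such that, for $m$-almost all $y\in E$, $T_y^{-1}(A)=A$ up to a $\mu$-null set. Let $L\log L(\mu)$ be the set of measurable functions $f$ on $X$ with $\int|f|\log^+|f|\,d\mu<\infty$. **Theorem.** Let $f\in L^1(\mu)$ be real- or complex-valued. For every $j\ge 0$ the expectation $$M_jf(x)=\int_\Omega f(T_\omega^j(x))\,d\nu(\omega)$$ is well defined for $\mu$-almost all $x\in X$ (the integrand is $\nu$-integrable), and $M_jf\in L^1(\mu)$. There is a function $\widetilde f\in L^1(\mu)$ such that: 1. $\displaystyle\lim_{n\to\infty}\frac1n\sum_{j=0}^{n-1}M_jf=\widetilde f$ in $L^1(\mu)$; 2. if $f\in L\log L(\mu)$, then also $\displaystyle\frac1n\sum_{j=0}^{n-1}M_jf(x)\to\widetilde f(x)$ for $\mu$-almost every $x\in X$; 3. if $\pi$ is strictly irreducible with respect to $m$, then $\widetilde f=\mathbb{E}[f\mid\Sigma]$ $\mu$-almost everywhere. -/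

import Mathlib

open MeasureTheory ProbabilityTheory Filter Topology
open scoped ENNReal

namespace RandomErgodic

/-- A Markov kernel `π` is strictly irreducible with respect to `m` if every deterministic
measurable set `B` (that is, `π(y, B) ∈ {0, 1}` for `m`-almost all `y`) has `m(B) ∈ {0, 1}`. -/
def StrictlyIrreducible {E : Type*} [MeasurableSpace E] (π : Kernel E E) (m : Measure E) : Prop :=
  ∀ B : Set E, MeasurableSet B → (∀ᵐ y ∂m, π y B = 0 ∨ π y B = 1) → m B = 0 ∨ m B = 1

/-- The transition kernel of the chain at time `n`, given the whole past `(ω₀, …, ωₙ)`: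
it is `π(ωₙ, ·)`. -/
noncomputable def stepKernel {E : Type*} [MeasurableSpace E] (π : Kernel E E) (n : ℕ) :
    Kernel (Finset.Iic n → E) E :=
  π.comap (fun x => x ⟨n, Finset.mem_Iic.2 le_rfl⟩) (measurable_pi_apply _)

instance instIsMarkovKernelStepKernel {E : Type*} [MeasurableSpace E] (π : Kernel E E)
    [IsMarkovKernel π] (n : ℕ) : IsMarkovKernel (stepKernel π n) := by
  unfold stepKernel; infer_instance

/-- The Markov measure on `ℕ → E` with initial law `m` and transition kernel `π`. -/
noncomputable def markovMeasure {E : Type*} [MeasurableSpace E] (π : Kernel E E)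
    [IsMarkovKernel π] (m : Measure E) : Measure (ℕ → E) :=
  Kernel.trajMeasure (X := fun _ => E) m (stepKernel π)

/-- The random composition `T_{ω (n-1)} ∘ ⋯ ∘ T_{ω 0}`. -/
def randomIterate {E X : Type*} (T : E → X → X) (ω : ℕ → E) : ℕ → X → X
  | 0 => id
  | n + 1 => T (ω n) ∘ randomIterate T ω n

/-- The expectation operators `M_n f (x) = ∫ f (T_ω^n x) dν(ω)`. -/
noncomputable def expectationOp {E X 𝕜 : Type*} [MeasurableSpace E] [RCLike 𝕜]
    (ν : Measure (ℕ → E)) (T : E → X → X) (n : ℕ) (f : X → 𝕜) (x : X) : 𝕜 :=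
  ∫ ω, f (randomIterate T ω n x) ∂ν

/-- The Cesàro averages `(1/n) ∑_{j < n} M_j f`. -/
noncomputable def cesaroMean {E X 𝕜 : Type*} [MeasurableSpace E] [RCLike 𝕜]
    (ν : Measure (ℕ → E)) (T : E → X → X) (f : X → 𝕜) (n : ℕ) (x : X) : 𝕜 :=
  (n : 𝕜)⁻¹ * ∑ j ∈ Finset.range n, expectationOp ν T j f x

/-- The class `L log L(μ)`: measurable functions with `∫ |f| log⁺ |f| dμ < ∞`. -/
def MemLLogL {X 𝕜 : Type*} [MeasurableSpace X] [RCLike 𝕜] (f : X → 𝕜) (μ : Measure X) : Prop :=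
  AEStronglyMeasurable f μ ∧ ∫⁻ x, ENNReal.ofReal (‖f x‖ * Real.posLog ‖f x‖) ∂μ < ∞

/-- The σ-algebra `Σ` of measurable sets `A` such that, for `m`-almost all `y`,
`T_y⁻¹ A = A` up to a `μ`-null set. -/
@[reducible] def invariantSigma {E X : Type*} [MeasurableSpace E] [mX : MeasurableSpace X]
    (T : E → X → X) (m : Measure E) (μ : Measure X) : MeasurableSpace X where
  MeasurableSet' A := MeasurableSet[mX] A ∧ ∀ᵐ y ∂m, T y ⁻¹' A =ᵐ[μ] A
  measurableSet_empty := ⟨MeasurableSet.empty, by simp⟩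
  measurableSet_compl A hA := ⟨hA.1.compl, by
    filter_upwards [hA.2] with y hy
    rw [Set.preimage_compl]
    exact hy.compl⟩
  measurableSet_iUnion A hA := ⟨MeasurableSet.iUnion fun i => (hA i).1, by
    filter_upwards [ae_all_iff.2 fun i => (hA i).2] with y hy
    rw [Set.preimage_iUnion]
    exact Filter.EventuallyEq.countable_iUnion hy⟩

end RandomErgodic

/-!
The expectation operators are averages along a Markov chain on `E × X`. Let `Q` be the kernel that
moves `(y, x)` to `(y', T_y x)` with `y'` drawn from `π(y, ·)` (`skewKernel`). It leaves `m ⊗ μ`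
invariant, and by the Markov property the law of `(ω_n, T_ω^n x)` under the Markov measure is that
of the `n`-th step of this chain started from `m ⊗ δ_x` (`markovMeasure_map_eq`). Hence, for almost
every `x`, the Cesàro mean of `f` at `x` is the integral over `y` of the average of
`F (y, x) = f x` along the powers of `Q` (`cesaroMean_eq_integral_kernelAvg`).

For a Markov kernel `Q` with invariant probability measure `ρ` the averages of an integrable `F`
converge in `L¹` and almost everywhere (`exists_kernelAvg_tendsto`). On `L²(ρ)` the Markov operator
is `J₁† J₂`, where `J₁` and `J₂` embed `L²(ρ)` into `L²(ρ ⊗ Q)` through the two coordinates; it is a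
contraction, so von Neumann's theorem applies, and equality in Cauchy–Schwarz shows that its fixed
vectors are constant along the transitions (`ae_eq_of_markovOp_fixed`). Almost everywhere
convergence follows from the maximal inequality (`mul_meas_lt_kernelMax_le`), which makes the set of
good functions closed in `L¹` (`ae_tendsto_kernelAvg_of_approx`), and from the telescoping
averages of `F - A_N F`.

The limit `h` on `E × X` gives the limit `g x = ∫ h (y, x) dm(y)`. Convergence in `L¹(μ)` is
Fubini's theorem. If `f` is in `L log L`, the maximal function of `F` is integrable
(`lintegral_kernelMax_lt_top`), so dominated convergence along the fibres `E × {x}` gives almost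
everywhere convergence. Finally, from almost every `y` the section `h (y', ·)` is the same for
`π(y, ·)`-almost every `y'`, because composition with the measure-preserving map `T_y` is injective
modulo null sets. Strict irreducibility then makes `∫_C h (y, ·) dμ` constant in `y` for each
measurable `C`, so `h (y, x) = g x` almost everywhere. Therefore `g` is invariant under almost every
`T_y`, hence measurable for the invariant σ-algebra, and it has the same integrals as `f` over the
sets of that σ-algebra (`StrictlyIrreducible.integral_fst_ae_eq_condExp`).
-/

namespace RandomErgodic

/-! ### Averages along a Markov kernel -/

section MarkovKernel

variable {Z 𝕜 : Type*} [MeasurableSpace Z] [RCLike 𝕜]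

instance instIsMarkovKernelPow (Q : Kernel Z Z) [IsMarkovKernel Q] (n : ℕ) :
    IsMarkovKernel (Q ^ n) := by
  induction n with
  | zero => exact inferInstanceAs (IsMarkovKernel (Kernel.id : Kernel Z Z))
  | succ n ih => exact inferInstanceAs (IsMarkovKernel ((Q ^ n) ∘ₖ Q))

/-- The Cesàro averages `(1/n) ∑_{j < n} ∫ F dQʲ(z, ·)` of a function along the powers of a
kernel. -/
noncomputable def kernelAvg (Q : Kernel Z Z) (F : Z → 𝕜) (n : ℕ) (z : Z) : 𝕜 :=
  (n : 𝕜)⁻¹ * ∑ j ∈ Finset.range n, ∫ w, F w ∂((Q ^ j) z)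

/-- The sums `∑_{j < n} ∫⁻ F dQʲ(z, ·)` of a nonnegative function along the powers of a kernel. -/
noncomputable def kernelSum (Q : Kernel Z Z) (F : Z → ℝ≥0∞) (n : ℕ) (z : Z) : ℝ≥0∞ :=
  ∑ j ∈ Finset.range n, ∫⁻ w, F w ∂((Q ^ j) z)

/-- The maximal function: the supremum over `n` of the Cesàro averages of a nonnegative function
along the powers of a kernel. The term `n = 0` is `0 / 0 = 0` in `ℝ≥0∞`. -/
noncomputable def kernelMax (Q : Kernel Z Z) (F : Z → ℝ≥0∞) (z : Z) : ℝ≥0∞ :=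
  ⨆ n : ℕ, kernelSum Q F n z / n

variable {Q : Kernel Z Z} {ρ : Measure Z}

lemma invariant_pow (hQ : Kernel.Invariant Q ρ) (n : ℕ) : Kernel.Invariant (Q ^ n) ρ := by
  induction n with
  | zero => exact Measure.bind_dirac
  | succ n ih => exact ih.comp hQ

lemma lintegral_lintegral_pow (hQ : Kernel.Invariant Q ρ) (n : ℕ) {F : Z → ℝ≥0∞}
    (hF : Measurable F) : ∫⁻ z, ∫⁻ w, F w ∂((Q ^ n) z) ∂ρ = ∫⁻ z, F z ∂ρ := by
  conv_rhs => rw [← (invariant_pow hQ n).def]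
  rw [Measure.lintegral_bind (Kernel.aemeasurable _) hF.aemeasurable]

lemma lintegral_lintegral_kernel (hQ : Kernel.Invariant Q ρ) {F : Z → ℝ≥0∞}
    (hF : Measurable F) : ∫⁻ z, ∫⁻ w, F w ∂(Q z) ∂ρ = ∫⁻ z, F z ∂ρ := by
  simpa using lintegral_lintegral_pow hQ 1 hF

lemma ae_ae_pow (hQ : Kernel.Invariant Q ρ) (n : ℕ) {p : Z → Prop} (h : ∀ᵐ z ∂ρ, p z) :
    ∀ᵐ z ∂ρ, ∀ᵐ w ∂((Q ^ n) z), p w := by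
  rw [← (invariant_pow hQ n).def] at h
  exact Measure.ae_ae_of_ae_comp h

lemma ae_forall_integrable_pow (hQ : Kernel.Invariant Q ρ) {F : Z → 𝕜} (hF : Integrable F ρ) :
    ∀ᵐ z ∂ρ, ∀ n : ℕ, Integrable F ((Q ^ n) z) := by
  refine ae_all_iff.2 fun n => ?_
  rw [← (invariant_pow hQ n).def] at hF
  exact Measure.ae_integrable_of_integrable_comp hF

lemma lintegral_pow_zero (F : Z → ℝ≥0∞) (hF : Measurable F) (z : Z) :
    ∫⁻ w, F w ∂((Q ^ 0) z) = F z :=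
  lintegral_dirac' z hF

lemma lintegral_pow_succ (n : ℕ) {F : Z → ℝ≥0∞} (hF : Measurable F) (z : Z) :
    ∫⁻ w, F w ∂((Q ^ (n + 1)) z) = ∫⁻ w, ∫⁻ v, F v ∂((Q ^ n) w) ∂(Q z) :=
  Kernel.lintegral_comp (Q ^ n) Q z hF

lemma measurable_kernelSum {F : Z → ℝ≥0∞} (hF : Measurable F) (n : ℕ) :
    Measurable (kernelSum Q F n) :=
  Finset.measurable_sum _ fun _ _ => hF.lintegral_kernel

lemma measurable_kernelMax {F : Z → ℝ≥0∞} (hF : Measurable F) : Measurable (kernelMax Q F) :=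
  Measurable.iSup fun n => (measurable_kernelSum hF n).div_const _

lemma kernelSum_succ {F : Z → ℝ≥0∞} (hF : Measurable F) (n : ℕ) (z : Z) :
    kernelSum Q F (n + 1) z = F z + ∫⁻ w, kernelSum Q F n w ∂(Q z) := by
  simp only [kernelSum]
  rw [Finset.sum_range_succ', lintegral_finsetSum _ fun _ _ => hF.lintegral_kernel, add_comm,
    lintegral_pow_zero F hF]
  simp only [lintegral_pow_succ _ hF]

lemma lintegral_kernelSum (hQ : Kernel.Invariant Q ρ) {F : Z → ℝ≥0∞} (hF : Measurable F) (n : ℕ) :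
    ∫⁻ z, kernelSum Q F n z ∂ρ = n * ∫⁻ z, F z ∂ρ := by
  simp only [kernelSum]
  rw [lintegral_finsetSum _ fun _ _ => hF.lintegral_kernel]
  simp [lintegral_lintegral_pow hQ _ hF]

/-! ### The maximal inequality -/

/-- The recursion `m₀ = 0`, `m_{N+1} = (F + Q m_N - c)⁺` behind the maximal inequality: `m_N`
dominates `0` and all the sums `∑_{j < k} Qʲ (F - c)` with `k ≤ N`. The positive part is encoded by
the truncated subtraction of `ℝ≥0∞`. -/
noncomputable def maxExcess (Q : Kernel Z Z) (F : Z → ℝ≥0∞) (c : ℝ≥0∞) : ℕ → Z → ℝ≥0∞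
  | 0 => 0
  | n + 1 => fun z => (F z + ∫⁻ w, maxExcess Q F c n w ∂(Q z)) - c

lemma measurable_maxExcess {F : Z → ℝ≥0∞} (hF : Measurable F) (c : ℝ≥0∞) (n : ℕ) :
    Measurable (maxExcess Q F c n) := by
  induction n with
  | zero => exact measurable_zero
  | succ n ih => exact (hF.add ih.lintegral_kernel).sub_const c

lemma monotone_maxExcess (F : Z → ℝ≥0∞) (c : ℝ≥0∞) : Monotone (maxExcess Q F c) := by
  refine monotone_nat_of_le_succ fun n => ?_
  induction n with
  | zero => exact fun z => zero_le
  | succ n ih =>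
    intro z
    exact tsub_le_tsub_right (by gcongr; exact ih _) _

lemma maxExcess_le_kernelSum {F : Z → ℝ≥0∞} (hF : Measurable F) (c : ℝ≥0∞) (n : ℕ) (z : Z) :
    maxExcess Q F c n z ≤ kernelSum Q F n z := by
  induction n generalizing z with
  | zero => exact zero_le
  | succ n ih =>
    rw [kernelSum_succ hF]
    refine tsub_le_self.trans ?_
    gcongr
    exact ih _

lemma kernelSum_le_maxExcess_add [IsMarkovKernel Q] {F : Z → ℝ≥0∞} (hF : Measurable F)
    (c : ℝ≥0∞) (n : ℕ) (z : Z) :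
    kernelSum Q F n z ≤ maxExcess Q F c n z + n * c := by
  induction n generalizing z with
  | zero => simp [kernelSum]
  | succ n ih =>
    rw [kernelSum_succ hF]
    calc F z + ∫⁻ w, kernelSum Q F n w ∂(Q z)
        ≤ F z + ∫⁻ w, (maxExcess Q F c n w + n * c) ∂(Q z) := by gcongr; exact ih _
      _ = (F z + ∫⁻ w, maxExcess Q F c n w ∂(Q z)) + n * c := by
          rw [lintegral_add_right _ measurable_const]; simp [add_assoc]
      _ ≤ (maxExcess Q F c (n + 1) z + c) + n * c :=
          add_le_add_left (le_tsub_add (b := F z + ∫⁻ w, maxExcess Q F c n w ∂(Q z))) _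
      _ = maxExcess Q F c (n + 1) z + (n + 1 : ℕ) * c := by push_cast; ring

/-- One level of the maximal inequality. On the set where `m_{N+1} > 0` the truncation is not
felt, so there `m_{N+1} + c = F + Q m_N`; integrating, the invariance of `ρ` and `m_N ≤ m_{N+1}`
let the two excess terms cancel. -/
lemma mul_meas_maxExcess_pos_le (hQ : Kernel.Invariant Q ρ) {F : Z → ℝ≥0∞}
    (hF : Measurable F) (c : ℝ≥0∞) (n : ℕ) :
    c * ρ {z | 0 < maxExcess Q F c n z} ≤ ∫⁻ z, F z ∂ρ := by
  rcases eq_or_ne (∫⁻ z, F z ∂ρ) ∞ with hF' | hF'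
  · simp [hF']
  cases n with
  | zero => simp [maxExcess]
  | succ n =>
    set D := {z | 0 < maxExcess Q F c (n + 1) z}
    have hD : MeasurableSet D := measurableSet_lt measurable_const (measurable_maxExcess hF c _)
    have hfin : ∫⁻ z, maxExcess Q F c (n + 1) z ∂ρ ≠ ∞ := by
      refine ne_top_of_le_ne_top ?_ (lintegral_mono (maxExcess_le_kernelSum hF c (n + 1)))
      rw [lintegral_kernelSum hQ hF]
      exact ENNReal.mul_ne_top (by simp) hF'
    have hoff : ∫⁻ z in D, maxExcess Q F c (n + 1) z ∂ρ
        = ∫⁻ z, maxExcess Q F c (n + 1) z ∂ρ := by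
      rw [← lintegral_indicator hD]
      refine lintegral_congr fun z => ?_
      by_cases hz : z ∈ D
      · simp [hz]
      · rw [Set.indicator_of_notMem hz]
        exact (nonpos_iff_eq_zero.1 (not_lt.1 hz)).symm
    have key : ∫⁻ z in D, (maxExcess Q F c (n + 1) z + c) ∂ρ
        ≤ ∫⁻ z in D, F z ∂ρ + ∫⁻ z, maxExcess Q F c (n + 1) z ∂ρ := by
      calc ∫⁻ z in D, (maxExcess Q F c (n + 1) z + c) ∂ρ
          = ∫⁻ z in D, (F z + ∫⁻ w, maxExcess Q F c n w ∂(Q z)) ∂ρ := by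
            refine setLIntegral_congr_fun hD fun z hz => ?_
            exact tsub_add_cancel_of_le (tsub_pos_iff_lt.1 hz).le
        _ = ∫⁻ z in D, F z ∂ρ + ∫⁻ z in D, ∫⁻ w, maxExcess Q F c n w ∂(Q z) ∂ρ :=
            lintegral_add_left hF _
        _ ≤ ∫⁻ z in D, F z ∂ρ + ∫⁻ z, ∫⁻ w, maxExcess Q F c n w ∂(Q z) ∂ρ := by
            gcongr; exact Measure.restrict_le_self
        _ ≤ ∫⁻ z in D, F z ∂ρ + ∫⁻ z, maxExcess Q F c (n + 1) z ∂ρ := by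
            rw [lintegral_lintegral_kernel hQ (measurable_maxExcess hF c n)]
            gcongr with z
            exact monotone_maxExcess F c (Nat.le_succ n) z
    rw [lintegral_add_right _ measurable_const, hoff, add_comm (∫⁻ z in D, F z ∂ρ)] at key
    have := (ENNReal.add_le_add_iff_left hfin).1 key
    rw [setLIntegral_const] at this
    exact this.trans (setLIntegral_le_lintegral _ _)

/-- The **maximal ergodic inequality** (weak type (1, 1)) for a Markov kernel with invariant
measure `ρ`. -/
lemma mul_meas_lt_kernelMax_le [IsMarkovKernel Q] (hQ : Kernel.Invariant Q ρ) {F : Z → ℝ≥0∞}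
    (hF : Measurable F) (c : ℝ≥0∞) :
    c * ρ {z | c < kernelMax Q F z} ≤ ∫⁻ z, F z ∂ρ := by
  -- If all `m_n z` vanish, then all the sums are at most `n c`.
  have hsub : {z | c < kernelMax Q F z} ⊆ ⋃ n, {z | 0 < maxExcess Q F c n z} := by
    intro z hz
    obtain ⟨n, hn⟩ := lt_iSup_iff.1 (show c < ⨆ n : ℕ, kernelSum Q F n z / n from hz)
    refine Set.mem_iUnion.2
      ⟨n, (pos_iff_ne_zero (a := maxExcess Q F c n z)).2 fun h0 => hn.not_ge ?_⟩
    have := kernelSum_le_maxExcess_add (Q := Q) hF c n z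
    rw [h0, zero_add] at this
    exact ENNReal.div_le_of_le_mul' this
  have hmono : Monotone fun n => {z | 0 < maxExcess Q F c n z} := fun a b hab z hz =>
    lt_of_lt_of_le hz (monotone_maxExcess F c hab z)
  calc c * ρ {z | c < kernelMax Q F z}
      ≤ c * ρ (⋃ n, {z | 0 < maxExcess Q F c n z}) := by gcongr
    _ = ⨆ n, c * ρ {z | 0 < maxExcess Q F c n z} := by
        rw [hmono.measure_iUnion, ENNReal.mul_iSup]
    _ ≤ _ := iSup_le fun n => mul_meas_maxExcess_pos_le hQ hF c n

end MarkovKernel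

section Integrability

variable {Z : Type*} [MeasurableSpace Z] {Q : Kernel Z Z} {ρ : Measure Z}

/-! ### Integrability of the maximal function for functions in `L log L` -/

lemma kernelMax_add_le {F G : Z → ℝ≥0∞} (hF : Measurable F) (z : Z) :
    kernelMax Q (F + G) z ≤ kernelMax Q F z + kernelMax Q G z := by
  refine iSup_le fun n => ?_
  have : kernelSum Q (F + G) n z = kernelSum Q F n z + kernelSum Q G n z := by
    simp only [kernelSum, Pi.add_apply, ← Finset.sum_add_distrib]
    exact Finset.sum_congr rfl fun j _ => lintegral_add_left hF _
  rw [this, ENNReal.add_div]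
  exact add_le_add (le_iSup (fun n : ℕ => kernelSum Q F n z / n) n)
    (le_iSup (fun n : ℕ => kernelSum Q G n z / n) n)

lemma kernelMax_mono {F G : Z → ℝ≥0∞} (h : F ≤ G) (z : Z) : kernelMax Q F z ≤ kernelMax Q G z :=
  iSup_mono fun _ => ENNReal.div_le_div_right
    (Finset.sum_le_sum fun _ _ => lintegral_mono h) _

lemma kernelMax_const_le [IsMarkovKernel Q] (c : ℝ≥0∞) (z : Z) :
    kernelMax Q (fun _ => c) z ≤ c :=
  iSup_le fun n => ENNReal.div_le_of_le_mul' (by simp [kernelSum])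

/-- The maximal inequality localized to large values: only the part of `F` above `c` contributes
to the event that the maximal function exceeds `2 c`. -/
lemma mul_meas_two_mul_lt_kernelMax_le [IsMarkovKernel Q] (hQ : Kernel.Invariant Q ρ)
    {F : Z → ℝ≥0∞} (hF : Measurable F) (c : ℝ≥0∞) (hc : c ≠ ∞) :
    c * ρ {z | 2 * c < kernelMax Q F z} ≤ ∫⁻ z, {z | c < F z}.indicator F z ∂ρ := by
  have hm : MeasurableSet {z | c < F z} := measurableSet_lt measurable_const hF
  refine le_trans ?_ (mul_meas_lt_kernelMax_le hQ (hF.indicator hm) c)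
  gcongr c * ρ ?_
  intro z hz
  have h1 : F ≤ {z | c < F z}.indicator F + fun _ => c := by
    intro w
    by_cases hw : c < F w
    · simp [hw]
    · simpa [hw] using not_lt.1 hw
  have h2 : kernelMax Q F z ≤ kernelMax Q ({z | c < F z}.indicator F) z + c :=
    (kernelMax_mono h1 z).trans
      ((kernelMax_add_le (hF.indicator hm) z).trans (by gcongr; exact kernelMax_const_le c z))
  have h3 := lt_of_lt_of_le hz h2
  rw [two_mul] at h3
  exact (ENNReal.add_lt_add_iff_right hc).1 h3

lemma le_two_add_tsum_dyadic (t : ℝ≥0∞) :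
    t ≤ 2 + ∑' k : ℕ, 2 * (2 ^ k * (if 2 * 2 ^ k < t then 1 else 0)) := by
  have hpart (K : ℕ) (hK : ∀ k < K, (2 : ℝ≥0∞) * 2 ^ k < t) :
      (2 : ℝ≥0∞) * 2 ^ K ≤ 2 + ∑' k : ℕ, 2 * (2 ^ k * (if 2 * 2 ^ k < t then 1 else 0)) := by
    have : ∀ K : ℕ, (2 : ℝ≥0∞) * 2 ^ K = 2 + ∑ k ∈ Finset.range K, 2 * 2 ^ k := by
      intro K
      induction K with
      | zero => simp
      | succ K ih => rw [Finset.sum_range_succ, ← add_assoc, ← ih]; ring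
    rw [this K]
    gcongr
    refine le_trans (Finset.sum_le_sum fun k hk => ?_) (ENNReal.sum_le_tsum (Finset.range K))
    rw [if_pos (hK k (Finset.mem_range.1 hk)), mul_one]
  by_cases hall : ∀ k : ℕ, (2 : ℝ≥0∞) * 2 ^ k < t
  · have htop : (⊤ : ℝ≥0∞) ≤ 2 + ∑' k : ℕ, 2 * (2 ^ k * (if 2 * 2 ^ k < t then 1 else 0)) := by
      refine ENNReal.le_of_forall_nnreal_lt fun r _ => ?_
      obtain ⟨n, hn⟩ := exists_nat_ge r
      refine le_trans ?_ (hpart n fun k _ => hall k)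
      have h1 : (r : ℝ≥0∞) ≤ n := by exact_mod_cast hn
      have h2 : (n : ℝ≥0∞) ≤ 2 ^ n := by exact_mod_cast n.lt_two_pow_self.le
      exact (h1.trans h2).trans (le_mul_of_one_le_left zero_le one_le_two)
    exact le_top.trans htop
  · push Not at hall
    classical
    exact (Nat.find_spec hall).trans
      (hpart _ fun k hk => not_le.1 (Nat.find_min hall hk))

lemma tsum_ite_two_pow_lt_le (r : ℝ) :
    ∑' k : ℕ, (if (2 : ℝ≥0∞) ^ k < ENNReal.ofReal r then (1 : ℝ≥0∞) else 0)
      ≤ 1 + 2 * ENNReal.ofReal (Real.posLog r) := by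
  have hsupp : ∀ k ∉ Finset.range ⌈2 * Real.posLog r⌉₊,
      (if (2 : ℝ≥0∞) ^ k < ENNReal.ofReal r then (1 : ℝ≥0∞) else 0) = 0 := by
    intro k hk
    rw [Finset.mem_range, not_lt, Nat.ceil_le] at hk
    refine if_neg fun h => hk.not_gt ?_
    have h' : (2 : ℝ) ^ k < r := by
      have h2 : ((2 : ℝ≥0∞) ^ k) = ENNReal.ofReal ((2 : ℝ) ^ k) := by
        rw [ENNReal.ofReal_pow (by norm_num)]; simp
      rw [h2] at h
      exact (ENNReal.ofReal_lt_ofReal_iff_of_nonneg (by positivity)).1 h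
    have hlog : (k : ℝ) * Real.log 2 < Real.log r := by
      rw [← Real.log_pow]
      exact Real.log_lt_log (by positivity) h'
    have hpos : Real.log r ≤ Real.posLog r := le_max_right _ _
    -- The factor `2` in the bound comes from `1 / log 2 < 2`.
    have hl2 : (1 / 2 : ℝ) < Real.log 2 := by linarith [Real.log_two_gt_d9]
    nlinarith [(Nat.cast_nonneg k : (0 : ℝ) ≤ k)]
  rw [tsum_eq_sum hsupp]
  calc _ ≤ ∑ _k ∈ Finset.range ⌈2 * Real.posLog r⌉₊, (1 : ℝ≥0∞) :=
        Finset.sum_le_sum fun k _ => by split_ifs <;> simp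
    _ = ENNReal.ofReal (⌈2 * Real.posLog r⌉₊ : ℝ) := by simp
    _ ≤ ENNReal.ofReal (1 + 2 * Real.posLog r) := by
        refine ENNReal.ofReal_le_ofReal ?_
        linarith [Nat.ceil_lt_add_one (mul_nonneg zero_le_two (Real.posLog_nonneg (x := r)))]
    _ = 1 + 2 * ENNReal.ofReal (Real.posLog r) := by
        rw [ENNReal.ofReal_add zero_le_one (by positivity [Real.posLog_nonneg (x := r)]),
          ENNReal.ofReal_mul zero_le_two]
        simp

/-- Wiener's dominated ergodic theorem for a Markov kernel: the maximal function of an integrable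
function in `L log L` is integrable. Dyadic levels of the localized maximal inequality are summed;
a point `z` is counted once for each `k` with `2 ^ k < F z`. -/
lemma lintegral_kernelMax_lt_top [IsMarkovKernel Q] [IsProbabilityMeasure ρ]
    (hQ : Kernel.Invariant Q ρ) {g : Z → ℝ} (hg : Measurable g) (hg0 : 0 ≤ g)
    (hint : ∫⁻ z, ENNReal.ofReal (g z) ∂ρ < ∞)
    (hlog : ∫⁻ z, ENNReal.ofReal (g z * Real.posLog (g z)) ∂ρ < ∞) :
    ∫⁻ z, kernelMax Q (fun z => ENNReal.ofReal (g z)) z ∂ρ < ∞ := by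
  set F : Z → ℝ≥0∞ := fun z => ENNReal.ofReal (g z) with hFdef
  have hF : Measurable F := hg.ennreal_ofReal
  have hM : Measurable (kernelMax Q F) := measurable_kernelMax hF
  have hset (k : ℕ) : MeasurableSet {z | (2 : ℝ≥0∞) ^ k < F z} :=
    measurableSet_lt measurable_const hF
  have hset2 (k : ℕ) : MeasurableSet {z | (2 : ℝ≥0∞) * 2 ^ k < kernelMax Q F z} :=
    measurableSet_lt measurable_const hM
  have hlevel (k : ℕ) : ∫⁻ z, 2 * (2 ^ k * (if 2 * 2 ^ k < kernelMax Q F z then 1 else 0)) ∂ρ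
      ≤ ∫⁻ z, 2 * {z | (2 : ℝ≥0∞) ^ k < F z}.indicator F z ∂ρ := by
    have h1 : ∀ z, (if (2 : ℝ≥0∞) * 2 ^ k < kernelMax Q F z then (1 : ℝ≥0∞) else 0)
        = {z | (2 : ℝ≥0∞) * 2 ^ k < kernelMax Q F z}.indicator 1 z := fun z => by
      simp [Set.indicator_apply]
    simp only [h1]
    rw [lintegral_const_mul _ ((measurable_one.indicator (hset2 k)).const_mul _),
      lintegral_const_mul _ (measurable_one.indicator (hset2 k)),
      lintegral_indicator_one (hset2 k), lintegral_const_mul _ (hF.indicator (hset k))]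
    gcongr
    exact mul_meas_two_mul_lt_kernelMax_le hQ hF _ (by simp)
  have hpt (z : Z) : ∑' k : ℕ, 2 * {z | (2 : ℝ≥0∞) ^ k < F z}.indicator F z
      ≤ 2 * F z + 4 * ENNReal.ofReal (g z * Real.posLog (g z)) := by
    have h1 : ∀ k : ℕ, 2 * {z | (2 : ℝ≥0∞) ^ k < F z}.indicator F z
        = 2 * F z * (if (2 : ℝ≥0∞) ^ k < ENNReal.ofReal (g z) then (1 : ℝ≥0∞) else 0) := fun k => by
      by_cases h : (2 : ℝ≥0∞) ^ k < ENNReal.ofReal (g z) <;> simp [hFdef, h]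
    simp only [h1]
    rw [ENNReal.tsum_mul_left, ENNReal.ofReal_mul (hg0 z)]
    calc _ ≤ 2 * F z * (1 + 2 * ENNReal.ofReal (Real.posLog (g z))) := by
          gcongr; exact tsum_ite_two_pow_lt_le _
      _ = _ := by rw [hFdef]; ring
  calc ∫⁻ z, kernelMax Q F z ∂ρ
      ≤ ∫⁻ z, (2 + ∑' k : ℕ, 2 * (2 ^ k * (if 2 * 2 ^ k < kernelMax Q F z then 1 else 0))) ∂ρ :=
        lintegral_mono fun z => le_two_add_tsum_dyadic _
    _ = 2 + ∑' k : ℕ, ∫⁻ z, 2 * (2 ^ k * (if 2 * 2 ^ k < kernelMax Q F z then 1 else 0)) ∂ρ := by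
        rw [lintegral_add_left measurable_const, lintegral_tsum fun k => (((measurable_const.ite
          (hset2 k) measurable_const).const_mul _).const_mul _).aemeasurable]
        simp
    _ ≤ 2 + ∑' k : ℕ, ∫⁻ z, 2 * {z | (2 : ℝ≥0∞) ^ k < F z}.indicator F z ∂ρ := by
        exact add_le_add le_rfl (ENNReal.tsum_le_tsum hlevel)
    _ = 2 + ∫⁻ z, ∑' k : ℕ, 2 * {z | (2 : ℝ≥0∞) ^ k < F z}.indicator F z ∂ρ := by
        rw [lintegral_tsum fun k => ((hF.indicator (hset k)).const_mul _).aemeasurable]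
    _ ≤ 2 + ∫⁻ z, (2 * F z + 4 * ENNReal.ofReal (g z * Real.posLog (g z))) ∂ρ := by
        gcongr with z; exact hpt z
    _ < ∞ := by
        rw [lintegral_add_left (hF.const_mul _), lintegral_const_mul _ hF,
          lintegral_const_mul' _ _ (by simp)]
        exact ENNReal.add_lt_top.2 ⟨by simp, ENNReal.add_lt_top.2
          ⟨ENNReal.mul_lt_top (by simp) hint, ENNReal.mul_lt_top (by simp) hlog⟩⟩

end Integrability

section MeanErgodic

variable {Z 𝕜 : Type*} [MeasurableSpace Z] [RCLike 𝕜] {Q : Kernel Z Z} {ρ : Measure Z}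

/-! ### The mean ergodic theorem for a Markov kernel -/

lemma integrable_pow_of_bounded [IsMarkovKernel Q] {F : Z → 𝕜} (hF : StronglyMeasurable F) {C : ℝ}
    (hC : ∀ z, ‖F z‖ ≤ C) (n : ℕ) (z : Z) : Integrable F ((Q ^ n) z) :=
  Integrable.of_bound hF.aestronglyMeasurable C (ae_of_all _ hC)

lemma integral_pow_succ_of_bounded [IsMarkovKernel Q] {F : Z → 𝕜} (hF : StronglyMeasurable F)
    {C : ℝ} (hC : ∀ z, ‖F z‖ ≤ C) (n : ℕ) (z : Z) :
    ∫ w, F w ∂((Q ^ (n + 1)) z) = ∫ w, ∫ v, F v ∂((Q ^ n) w) ∂(Q z) :=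
  Kernel.integral_comp (integrable_pow_of_bounded hF hC (n + 1) z)

lemma stronglyMeasurable_integral_pow [IsMarkovKernel Q] {F : Z → 𝕜} (hF : StronglyMeasurable F)
    (n : ℕ) : StronglyMeasurable fun z => ∫ w, F w ∂((Q ^ n) z) :=
  hF.integral_kernel

lemma norm_integral_pow_le [IsMarkovKernel Q] {F : Z → 𝕜} {C : ℝ}
    (hC : ∀ z, ‖F z‖ ≤ C) (n : ℕ) (z : Z) : ‖∫ w, F w ∂((Q ^ n) z)‖ ≤ C := by
  simpa using norm_integral_le_of_norm_le_const (ae_of_all ((Q ^ n) z) hC)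

lemma stronglyMeasurable_kernelAvg [IsMarkovKernel Q] {F : Z → 𝕜} (hF : StronglyMeasurable F)
    (n : ℕ) : StronglyMeasurable (kernelAvg Q F n) := by
  unfold kernelAvg
  exact (Finset.stronglyMeasurable_fun_sum _
    fun j _ => stronglyMeasurable_integral_pow hF j).const_mul _

lemma norm_kernelAvg_le [IsMarkovKernel Q] {F : Z → 𝕜} {C : ℝ}
    (hC : ∀ z, ‖F z‖ ≤ C) (hC0 : 0 ≤ C) (n : ℕ) (z : Z) : ‖kernelAvg Q F n z‖ ≤ C := by
  rcases n.eq_zero_or_pos with rfl | hn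
  · simpa [kernelAvg] using hC0
  have hn' : (0 : ℝ) < n := by exact_mod_cast hn
  have : ‖∑ j ∈ Finset.range n, ∫ w, F w ∂((Q ^ j) z)‖ ≤ n * C := by
    refine (norm_sum_le_of_le _ fun j _ => norm_integral_pow_le hC j z).trans ?_
    simp
  rw [kernelAvg, norm_mul, norm_inv, RCLike.norm_natCast, inv_mul_le_iff₀ hn']
  exact this

section Hilbert

variable [IsMarkovKernel Q] [IsProbabilityMeasure ρ]

lemma measurePreserving_fst_compProd : MeasurePreserving Prod.fst (ρ ⊗ₘ Q) ρ :=
  ⟨measurable_fst, Measure.fst_compProd ρ Q⟩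

lemma measurePreserving_snd_compProd (hQ : Kernel.Invariant Q ρ) :
    MeasurePreserving Prod.snd (ρ ⊗ₘ Q) ρ :=
  ⟨measurable_snd, (Measure.snd_compProd ρ Q).trans hQ.def⟩

/-- The embedding of `L²(ρ)` into `L²(ρ ⊗ₘ Q)` as functions of the first coordinate. -/
noncomputable def embFst (𝕜 : Type*) [RCLike 𝕜] (Q : Kernel Z Z) (ρ : Measure Z) [IsMarkovKernel Q]
    [IsProbabilityMeasure ρ] : Lp 𝕜 2 ρ →ₗᵢ[𝕜] Lp 𝕜 2 (ρ ⊗ₘ Q) :=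
  Lp.compMeasurePreservingₗᵢ 𝕜 Prod.fst measurePreserving_fst_compProd

/-- The embedding of `L²(ρ)` into `L²(ρ ⊗ₘ Q)` as functions of the second coordinate. -/
noncomputable def embSnd (𝕜 : Type*) [RCLike 𝕜] {Q : Kernel Z Z} {ρ : Measure Z} [IsMarkovKernel Q]
    [IsProbabilityMeasure ρ] (hQ : Kernel.Invariant Q ρ) :
    Lp 𝕜 2 ρ →ₗᵢ[𝕜] Lp 𝕜 2 (ρ ⊗ₘ Q) :=
  Lp.compMeasurePreservingₗᵢ 𝕜 Prod.snd (measurePreserving_snd_compProd hQ)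

/-- The Markov operator of `Q` on `L²(ρ)`: the expectation of a function of the second coordinate
of `ρ ⊗ₘ Q` given the first one, written as the adjoint of the first embedding after the second
embedding. -/
noncomputable def markovOp (𝕜 : Type*) [RCLike 𝕜] {Q : Kernel Z Z} {ρ : Measure Z}
    [IsMarkovKernel Q] [IsProbabilityMeasure ρ] (hQ : Kernel.Invariant Q ρ) :
    Lp 𝕜 2 ρ →L[𝕜] Lp 𝕜 2 ρ :=
  ContinuousLinearMap.adjoint (embFst 𝕜 Q ρ).toContinuousLinearMap ∘L
    (embSnd 𝕜 hQ).toContinuousLinearMap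

lemma norm_markovOp_le (hQ : Kernel.Invariant Q ρ) : ‖markovOp 𝕜 hQ‖ ≤ 1 := by
  refine (ContinuousLinearMap.opNorm_comp_le _ _).trans ?_
  rw [LinearIsometryEquiv.norm_map]
  exact mul_le_one₀ (LinearIsometry.norm_toContinuousLinearMap_le _) (norm_nonneg _)
    (LinearIsometry.norm_toContinuousLinearMap_le _)

/-- A fixed vector of the Markov operator is constant along the transitions of the chain: equality
holds in the Cauchy–Schwarz inequality for its two embeddings. -/
lemma ae_eq_of_markovOp_fixed (hQ : Kernel.Invariant Q ρ) {h : Lp 𝕜 2 ρ}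
    (hh : markovOp 𝕜 hQ h = h) : ∀ᵐ z ∂ρ, ∀ᵐ w ∂(Q z), h w = h z := by
  have h0 : embSnd 𝕜 hQ h = embFst 𝕜 Q ρ h := by
    refine eq_of_norm_le_re_inner_eq_norm_sq (𝕜 := 𝕜) ?_ ?_
    · rw [LinearIsometry.norm_map, LinearIsometry.norm_map]
    · have h1 : inner 𝕜 (embSnd 𝕜 hQ h) (embFst 𝕜 Q ρ h) = inner 𝕜 (markovOp 𝕜 hQ h) h := by
        rw [markovOp, ContinuousLinearMap.comp_apply, ContinuousLinearMap.adjoint_inner_left]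
        rfl
      rw [h1, hh, LinearIsometry.norm_map, inner_self_eq_norm_sq_to_K]
      norm_cast
  have h1 := Lp.coeFn_compMeasurePreserving h (measurePreserving_fst_compProd (Q := Q) (ρ := ρ))
  have h2 := Lp.coeFn_compMeasurePreserving h (measurePreserving_snd_compProd hQ)
  have h3 : (fun p : Z × Z => h p.2) =ᵐ[ρ ⊗ₘ Q] fun p => h p.1 := by
    refine h2.symm.trans (EventuallyEq.trans ?_ h1)
    exact EventuallyEq.of_eq (congrArg (fun u : Lp 𝕜 2 (ρ ⊗ₘ Q) => (u : Z × Z → 𝕜)) h0)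
  exact Measure.ae_ae_of_ae_compProd h3

lemma memLp_of_bounded {F : Z → 𝕜} (hF : StronglyMeasurable F) {C : ℝ} (hC : ∀ z, ‖F z‖ ≤ C)
    (p : ℝ≥0∞) : MemLp F p ρ :=
  MemLp.of_bound hF.aestronglyMeasurable C (ae_of_all _ hC)

lemma markovOp_toLp (hQ : Kernel.Invariant Q ρ) {F : Z → 𝕜} (hF : StronglyMeasurable F) {C : ℝ}
    (hC : ∀ z, ‖F z‖ ≤ C) {G : Z → 𝕜} (hG : MemLp G 2 ρ) (hGF : ∀ z, G z = ∫ w, F w ∂(Q z)) :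
    markovOp 𝕜 hQ ((memLp_of_bounded (ρ := ρ) hF hC 2).toLp F) = hG.toLp G := by
  refine ext_inner_left 𝕜 fun v => ?_
  rw [markovOp, ContinuousLinearMap.comp_apply, ContinuousLinearMap.adjoint_inner_right,
    L2.inner_def, L2.inner_def]
  set FL := (memLp_of_bounded (ρ := ρ) hF hC 2).toLp F with hFL
  have h1 := Lp.coeFn_compMeasurePreserving v (measurePreserving_fst_compProd (Q := Q) (ρ := ρ))
  have h2 := Lp.coeFn_compMeasurePreserving FL (measurePreserving_snd_compProd hQ)
  have h3 : (fun p : Z × Z => FL p.2) =ᵐ[ρ ⊗ₘ Q] fun p => F p.2 :=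
    (measurePreserving_snd_compProd hQ).quasiMeasurePreserving.ae_eq_comp
      (MemLp.coeFn_toLp (memLp_of_bounded (ρ := ρ) hF hC 2))
  have h4 : (fun p => inner 𝕜 (((embFst 𝕜 Q ρ).toContinuousLinearMap v : Lp 𝕜 2 (ρ ⊗ₘ Q)) p)
      (((embSnd 𝕜 hQ).toContinuousLinearMap FL : Lp 𝕜 2 (ρ ⊗ₘ Q)) p))
      =ᵐ[ρ ⊗ₘ Q] fun p => inner 𝕜 (v p.1) (F p.2) := by
    filter_upwards [h1, h2, h3] with p hp1 hp2 hp3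
    change inner 𝕜 (Lp.compMeasurePreserving Prod.fst _ v p)
      (Lp.compMeasurePreserving Prod.snd _ FL p) = _
    rw [hp1, hp2]
    simp only [Function.comp_apply, hp3]
  rw [integral_congr_ae h4, Measure.integral_compProd ((L2.integrable_inner _ _).congr h4)]
  refine integral_congr_ae ?_
  filter_upwards [hG.coeFn_toLp] with z hz
  rw [hz, hGF z]
  simp only [RCLike.inner_apply']
  exact integral_const_mul _ _

lemma kernelAvg_toLp (hQ : Kernel.Invariant Q ρ) {F : Z → 𝕜} (hF : StronglyMeasurable F) {C : ℝ}
    (hC : ∀ z, ‖F z‖ ≤ C) (hC0 : 0 ≤ C) (n : ℕ) :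
    birkhoffAverage 𝕜 (markovOp 𝕜 hQ) id n ((memLp_of_bounded (ρ := ρ) hF hC 2).toLp F)
      = (memLp_of_bounded (ρ := ρ) (stronglyMeasurable_kernelAvg (Q := Q) hF n)
          (norm_kernelAvg_le hC hC0 n) 2).toLp _ := by
  have hiter (j : ℕ) : (markovOp 𝕜 hQ)^[j] ((memLp_of_bounded (ρ := ρ) hF hC 2).toLp F)
      = (memLp_of_bounded (ρ := ρ) (stronglyMeasurable_integral_pow (Q := Q) hF j)
          (norm_integral_pow_le hC j) 2).toLp _ := by
    induction j with
    | zero =>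
      refine (MemLp.toLp_congr _ _ (ae_of_all _ fun z => ?_))
      exact (integral_dirac' F z hF).symm
    | succ j ih =>
      rw [Function.iterate_succ_apply', ih]
      exact markovOp_toLp hQ (stronglyMeasurable_integral_pow hF j) (norm_integral_pow_le hC j) _
        (integral_pow_succ_of_bounded hF hC j)
  refine Lp.ext ?_
  have hsum : ∀ᵐ z ∂ρ, ∀ j : ℕ,
      ((markovOp 𝕜 hQ)^[j] ((memLp_of_bounded (ρ := ρ) hF hC 2).toLp F) : Lp 𝕜 2 ρ) z
        = ∫ w, F w ∂((Q ^ j) z) := by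
    refine ae_all_iff.2 fun j => ?_
    rw [hiter j]
    exact MemLp.coeFn_toLp _
  refine EventuallyEq.trans ?_ (MemLp.coeFn_toLp _).symm
  rw [birkhoffAverage, birkhoffSum]
  filter_upwards [hsum, Lp.coeFn_smul ((n : 𝕜)⁻¹) (∑ j ∈ Finset.range n,
    id ((markovOp 𝕜 hQ)^[j] ((memLp_of_bounded (ρ := ρ) hF hC 2).toLp F))),
    Lp.coeFn_finsetSum (Finset.range n) fun j =>
      id ((markovOp 𝕜 hQ)^[j] ((memLp_of_bounded (ρ := ρ) hF hC 2).toLp F))] with z h1 h2 h3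
  rw [h2, Pi.smul_apply, h3, Finset.sum_apply, kernelAvg, smul_eq_mul]
  simp only [id, h1]

/-- The mean ergodic theorem for bounded functions. The limit is constant along the transitions of
the chain. -/
lemma exists_kernelAvg_tendsto_of_bounded (hQ : Kernel.Invariant Q ρ) {F : Z → 𝕜}
    (hF : StronglyMeasurable F) {C : ℝ} (hC : ∀ z, ‖F z‖ ≤ C) (hC0 : 0 ≤ C) :
    ∃ h : Z → 𝕜, StronglyMeasurable h ∧ Integrable h ρ ∧
      (∀ᵐ z ∂ρ, ∀ᵐ w ∂(Q z), h w = h z) ∧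
      Tendsto (fun n => eLpNorm (kernelAvg Q F n - h) 1 ρ) atTop (𝓝 0) := by
  set x := (memLp_of_bounded (ρ := ρ) hF hC 2).toLp F
  have hlim := (markovOp 𝕜 hQ).tendsto_birkhoffAverage_orthogonalProjection
    (norm_markovOp_le hQ) x
  set y := ((markovOp 𝕜 hQ).eqLocus (1 : Lp 𝕜 2 ρ →L[𝕜] Lp 𝕜 2 ρ)).orthogonalProjectionOnto x
  have hy : markovOp 𝕜 hQ (y : Lp 𝕜 2 ρ) = y := y.2
  refine ⟨(y : Lp 𝕜 2 ρ), Lp.stronglyMeasurable _,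
    (Lp.memLp (y : Lp 𝕜 2 ρ)).integrable (by norm_num),
    ae_eq_of_markovOp_fixed hQ hy, ?_⟩
  rw [Lp.tendsto_Lp_iff_tendsto_eLpNorm'] at hlim
  refine tendsto_of_tendsto_of_tendsto_of_le_of_le tendsto_const_nhds hlim
    (fun _ => zero_le) fun n => ?_
  rw [kernelAvg_toLp hQ hF hC hC0]
  have hc := MemLp.coeFn_toLp (memLp_of_bounded (ρ := ρ)
    (stronglyMeasurable_kernelAvg (Q := Q) hF n) (norm_kernelAvg_le hC hC0 n) 2)
  refine le_trans (le_of_eq (eLpNorm_congr_ae ?_))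
    (eLpNorm_le_eLpNorm_of_exponent_le (by norm_num : (1 : ℝ≥0∞) ≤ 2) ?_)
  · filter_upwards [hc] with z hz
    simp [hz]
  · exact ((Lp.aestronglyMeasurable _).sub (Lp.aestronglyMeasurable _))

end Hilbert
end MeanErgodic

section PointwiseErgodic

variable {Z 𝕜 : Type*} [MeasurableSpace Z] [RCLike 𝕜] {Q : Kernel Z Z} {ρ : Measure Z}

/-! ### Averages of integrable functions -/

lemma enorm_kernelAvg_le (F : Z → 𝕜) (n : ℕ) (z : Z) :
    ‖kernelAvg Q F n z‖ₑ ≤ kernelSum Q (fun w => ‖F w‖ₑ) n z / n := by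
  rcases n.eq_zero_or_pos with rfl | hn
  · simp [kernelAvg]
  have hn' : (n : 𝕜) ≠ 0 := by exact_mod_cast hn.ne'
  rw [kernelAvg, enorm_mul, enorm_inv hn', div_eq_mul_inv, mul_comm]
  have h1 : ‖(n : 𝕜)‖ₑ = n := by
    rw [← ofReal_norm, RCLike.norm_natCast, ENNReal.ofReal_natCast]
  rw [h1]
  gcongr
  exact (enorm_sum_le _ _).trans (Finset.sum_le_sum fun j _ => enorm_integral_le_lintegral_enorm _)

lemma enorm_kernelAvg_le_kernelMax (F : Z → 𝕜) (n : ℕ) (z : Z) :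
    ‖kernelAvg Q F n z‖ₑ ≤ kernelMax Q (fun w => ‖F w‖ₑ) z :=
  (enorm_kernelAvg_le F n z).trans
    (le_iSup (fun n : ℕ => kernelSum Q (fun w => ‖F w‖ₑ) n z / n) n)

lemma eLpNorm_kernelAvg_le (hQ : Kernel.Invariant Q ρ) {F : Z → 𝕜} (hF : StronglyMeasurable F)
    (n : ℕ) : eLpNorm (kernelAvg Q F n) 1 ρ ≤ eLpNorm F 1 ρ := by
  rw [eLpNorm_one_eq_lintegral_enorm, eLpNorm_one_eq_lintegral_enorm]
  refine (lintegral_mono fun z => enorm_kernelAvg_le F n z).trans ?_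
  simp only [div_eq_mul_inv]
  rw [lintegral_mul_const _ (measurable_kernelSum hF.enorm n), lintegral_kernelSum hQ hF.enorm,
    ← div_eq_mul_inv]
  exact ENNReal.div_le_of_le_mul' le_rfl

lemma kernelAvg_sub {F G : Z → 𝕜} {z : Z} (hF : ∀ j, Integrable F ((Q ^ j) z))
    (hG : ∀ j, Integrable G ((Q ^ j) z)) (n : ℕ) :
    kernelAvg Q (F - G) n z = kernelAvg Q F n z - kernelAvg Q G n z := by
  rw [kernelAvg, kernelAvg, kernelAvg, ← mul_sub, ← Finset.sum_sub_distrib]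
  congr 1
  exact Finset.sum_congr rfl fun j _ => integral_sub (hF j) (hG j)

lemma kernelAvg_add {F G : Z → 𝕜} {z : Z} (hF : ∀ j, Integrable F ((Q ^ j) z))
    (hG : ∀ j, Integrable G ((Q ^ j) z)) (n : ℕ) :
    kernelAvg Q (F + G) n z = kernelAvg Q F n z + kernelAvg Q G n z := by
  rw [kernelAvg, kernelAvg, kernelAvg, ← mul_add, ← Finset.sum_add_distrib]
  congr 1
  exact Finset.sum_congr rfl fun j _ => integral_add (hF j) (hG j)

lemma eLpNorm_kernelAvg_sub_le (hQ : Kernel.Invariant Q ρ) {F G : Z → 𝕜}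
    (hF : StronglyMeasurable F) (hG : StronglyMeasurable G) (hFi : Integrable F ρ)
    (hGi : Integrable G ρ) (n : ℕ) :
    eLpNorm (kernelAvg Q F n - kernelAvg Q G n) 1 ρ ≤ eLpNorm (F - G) 1 ρ := by
  refine le_trans (le_of_eq (eLpNorm_congr_ae ?_)) (eLpNorm_kernelAvg_le hQ (hF.sub hG) n)
  filter_upwards [ae_forall_integrable_pow hQ hFi, ae_forall_integrable_pow hQ hGi] with z h1 h2
  exact (kernelAvg_sub h1 h2 n).symm

/-- The Banach principle: by the maximal inequality, almost everywhere convergence of the averages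
is preserved under `L¹` limits. -/
lemma ae_tendsto_kernelAvg_of_approx [IsMarkovKernel Q] (hQ : Kernel.Invariant Q ρ)
    {F h : Z → 𝕜} {Fs hs : ℕ → Z → 𝕜} (hF : StronglyMeasurable F) (hFi : Integrable F ρ)
    (hh : StronglyMeasurable h) (hFs : ∀ k, StronglyMeasurable (Fs k))
    (hFsi : ∀ k, Integrable (Fs k) ρ) (hhs : ∀ k, StronglyMeasurable (hs k))
    (hFlim : Tendsto (fun k => eLpNorm (F - Fs k) 1 ρ) atTop (𝓝 0))
    (hhlim : Tendsto (fun k => eLpNorm (hs k - h) 1 ρ) atTop (𝓝 0))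
    (hconv : ∀ k, ∀ᵐ z ∂ρ, Tendsto (fun n => kernelAvg Q (Fs k) n z) atTop (𝓝 (hs k z))) :
    ∀ᵐ z ∂ρ, Tendsto (fun n => kernelAvg Q F n z) atTop (𝓝 (h z)) := by
  have key (ε : ℝ≥0∞) (hε : 0 < ε) (hε' : ε ≠ ∞) :
      ∀ᵐ z ∂ρ, ∀ᶠ n in atTop, ‖kernelAvg Q F n z - h z‖ₑ ≤ ε + (ε + ε) := by
    rw [ae_iff]
    set B := {z | ¬ ∀ᶠ n in atTop, ‖kernelAvg Q F n z - h z‖ₑ ≤ ε + (ε + ε)}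
    have hB (k : ℕ) : ε * ρ B ≤ eLpNorm (F - Fs k) 1 ρ + eLpNorm (hs k - h) 1 ρ := by
      set B1 := {z | ε < kernelMax Q (fun w => ‖(F - Fs k) w‖ₑ) z}
      set B2 := {z | ε ≤ ‖(hs k - h) z‖ₑ}
      have hsub : B ≤ᵐ[ρ] (B1 ∪ B2 : Set Z) := by
        filter_upwards [hconv k, ae_forall_integrable_pow hQ hFi,
          ae_forall_integrable_pow hQ (hFsi k)] with z h1 h2 h3 hzB
        by_contra hz
        obtain ⟨hz1, hz2⟩ := not_or.1 hz
        refine hzB ?_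
        have h4 : ∀ᶠ n in atTop, edist (kernelAvg Q (Fs k) n z) (hs k z) < ε :=
          h1.eventually (Metric.eball_mem_nhds _ hε)
        filter_upwards [h4] with n hn
        have e : kernelAvg Q F n z - h z = kernelAvg Q (F - Fs k) n z
            + ((kernelAvg Q (Fs k) n z - hs k z) + (hs k - h) z) := by
          rw [kernelAvg_sub h2 h3, Pi.sub_apply]; ring
        rw [e]
        refine (enorm_add_le _ _).trans (add_le_add ?_
          ((enorm_add_le _ _).trans (add_le_add ?_ ?_)))
        · exact (enorm_kernelAvg_le_kernelMax _ n z).trans (not_lt.1 hz1)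
        · rw [← edist_eq_enorm_sub]; exact hn.le
        · exact (not_le.1 hz2).le
      calc ε * ρ B ≤ ε * (ρ B1 + ρ B2) := by
            gcongr
            exact (measure_mono_ae hsub).trans (measure_union_le _ _)
        _ = ε * ρ B1 + ε * ρ B2 := mul_add _ _ _
        _ ≤ _ := by
            rw [eLpNorm_one_eq_lintegral_enorm, eLpNorm_one_eq_lintegral_enorm]
            exact add_le_add (mul_meas_lt_kernelMax_le hQ (hF.sub (hFs k)).enorm ε)
              (mul_meas_ge_le_lintegral ((hhs k).sub hh).enorm ε)
    have hlim := hFlim.add hhlim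
    rw [add_zero] at hlim
    have : ε * ρ B ≤ 0 := ge_of_tendsto' hlim hB
    exact (mul_eq_zero.1 (nonpos_iff_eq_zero.1 this)).resolve_left hε.ne'
  obtain ⟨u, -, hu, hu0⟩ := exists_seq_strictAnti_tendsto' (show (0 : ℝ≥0∞) < 1 by simp)
  have hall : ∀ᵐ z ∂ρ, ∀ k, ∀ᶠ n in atTop,
      ‖kernelAvg Q F n z - h z‖ₑ ≤ u k + (u k + u k) :=
    ae_all_iff.2 fun k => key (u k) (hu k).1 ((hu k).2.trans ENNReal.one_lt_top).ne
  filter_upwards [hall] with z hz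
  rw [tendsto_iff_edist_tendsto_0, ENNReal.tendsto_nhds_zero]
  intro ε hε
  have h3 : Tendsto (fun k => u k + (u k + u k)) atTop (𝓝 0) := by
    simpa using hu0.add (hu0.add hu0)
  obtain ⟨k, hk⟩ := (ENNReal.tendsto_nhds_zero.1 h3 ε hε).exists
  filter_upwards [hz k] with n hn
  rw [edist_eq_enorm_sub]
  exact hn.trans hk

/-! ### Functions that are constant along the transitions of the chain -/

lemma ae_ae_pow_eq (hQ : Kernel.Invariant Q ρ) {h : Z → 𝕜} (hm : StronglyMeasurable h)
    (hh : ∀ᵐ z ∂ρ, ∀ᵐ w ∂(Q z), h w = h z) (n : ℕ) :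
    ∀ᵐ z ∂ρ, ∀ᵐ w ∂((Q ^ n) z), h w = h z := by
  have hset (c : 𝕜) : MeasurableSet {w | h w = c} :=
    hm.measurable (measurableSet_singleton c)
  induction n with
  | zero =>
    refine ae_of_all _ fun z => ?_
    have : (Q ^ 0) z = Measure.dirac z := rfl
    rw [this, ae_dirac_iff (hset _)]
  | succ n ih =>
    have h1 := ae_ae_pow hQ 1 ih
    rw [pow_one] at h1
    filter_upwards [hh, h1] with z hz1 hz2
    have : (Q ^ (n + 1)) z = (Q ^ n) ∘ₘ (Q z) := rfl
    rw [this]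
    refine Measure.ae_comp_of_ae_ae (hset _) ?_
    filter_upwards [hz1, hz2] with w hw1 hw2
    filter_upwards [hw2] with v hv
    rw [hv, hw1]

lemma ae_kernelAvg_eq_self [IsMarkovKernel Q] (hQ : Kernel.Invariant Q ρ) {h : Z → 𝕜}
    (hm : StronglyMeasurable h) (hh : ∀ᵐ z ∂ρ, ∀ᵐ w ∂(Q z), h w = h z) :
    ∀ᵐ z ∂ρ, ∀ n : ℕ, n ≠ 0 → kernelAvg Q h n z = h z := by
  filter_upwards [ae_all_iff.2 (ae_ae_pow_eq hQ hm hh)] with z hz n hn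
  have hn' : (n : 𝕜) ≠ 0 := by exact_mod_cast hn
  have : ∀ j ∈ Finset.range n, ∫ w, h w ∂((Q ^ j) z) = h z := fun j _ => by
    rw [integral_congr_ae (hz j)]; simp
  rw [kernelAvg, Finset.sum_congr rfl this]
  simp [hn']

lemma integral_integral_pow [IsMarkovKernel Q] [IsProbabilityMeasure ρ]
    (hQ : Kernel.Invariant Q ρ) {G : Z → 𝕜} (hG : Integrable G ρ) (n : ℕ) :
    ∫ z, ∫ w, G w ∂((Q ^ n) z) ∂ρ = ∫ z, G z ∂ρ := by
  have h1 := measurePreserving_snd_compProd (ρ := ρ) (invariant_pow hQ n)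
  have h2 : Integrable (fun p : Z × Z => G p.2) (ρ ⊗ₘ (Q ^ n)) :=
    h1.integrable_comp_of_integrable hG
  rw [← Measure.integral_compProd h2]
  conv_rhs => rw [← h1.map_eq]
  rw [integral_map h1.measurable.aemeasurable (by rw [h1.map_eq]; exact hG.aestronglyMeasurable)]

lemma integrable_integral_pow (hQ : Kernel.Invariant Q ρ) {F : Z → 𝕜} (hF : Integrable F ρ)
    (n : ℕ) : Integrable (fun z => ∫ w, F w ∂((Q ^ n) z)) ρ := by
  have h : Integrable F (((Q ^ n) ∘ₖ Kernel.const Unit ρ) ()) := by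
    rw [← Measure.comp_eq_comp_const_apply, (invariant_pow hQ n).def]
    exact hF
  exact h.integral_comp

/-- The averages of `F` have the same integral as `F` over a set that the chain neither enters nor
leaves. -/
lemma setIntegral_kernelAvg [IsMarkovKernel Q] [IsProbabilityMeasure ρ]
    (hQ : Kernel.Invariant Q ρ) {F : Z → 𝕜} (hF : Integrable F ρ) {A : Set Z}
    (hA : MeasurableSet A) (hAinv : ∀ᵐ z ∂ρ, ∀ᵐ w ∂(Q z), w ∈ A ↔ z ∈ A) {n : ℕ} (hn : n ≠ 0) :
    ∫ z in A, kernelAvg Q F n z ∂ρ = ∫ z in A, F z ∂ρ := by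
  have hn' : (n : 𝕜) ≠ 0 := by exact_mod_cast hn
  have h1 : ∀ᵐ z ∂ρ, ∀ᵐ w ∂(Q z), A.indicator (1 : Z → 𝕜) w = A.indicator (1 : Z → 𝕜) z := by
    filter_upwards [hAinv] with z hz
    filter_upwards [hz] with w hw
    by_cases hzA : z ∈ A
    · rw [Set.indicator_of_mem (hw.2 hzA), Set.indicator_of_mem hzA]; rfl
    · rw [Set.indicator_of_notMem (mt hw.1 hzA), Set.indicator_of_notMem hzA]
  have hpow (j : ℕ) : ∫ z in A, ∫ w, F w ∂((Q ^ j) z) ∂ρ = ∫ z in A, F z ∂ρ := by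
    rw [← integral_indicator hA, ← integral_indicator hA,
      ← integral_integral_pow hQ (hF.indicator hA) j]
    refine integral_congr_ae ?_
    filter_upwards [ae_ae_pow_eq hQ (stronglyMeasurable_one.indicator hA) h1 j] with z hz
    have h2 : ∀ᵐ w ∂((Q ^ j) z), A.indicator F w = A.indicator (1 : Z → 𝕜) z * F w := by
      filter_upwards [hz] with w hw
      rw [← hw]
      by_cases hwA : w ∈ A <;> simp [hwA]
    rw [integral_congr_ae h2, integral_const_mul]
    by_cases hzA : z ∈ A <;> simp [hzA]
  simp only [kernelAvg]
  rw [integral_const_mul, integral_finsetSum _ fun j _ =>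
    (integrable_integral_pow hQ hF j).integrableOn]
  simp [hpow, hn']

/-! ### The pointwise ergodic theorem for a Markov kernel -/

lemma tendsto_average_sub_shift {a : ℕ → 𝕜} {C : ℝ} (ha : ∀ j, ‖a j‖ ≤ C) (k : ℕ) :
    Tendsto (fun n : ℕ => (n : 𝕜)⁻¹ * ∑ j ∈ Finset.range n, a j
      - (n : 𝕜)⁻¹ * ∑ j ∈ Finset.range n, a (k + j)) atTop (𝓝 0) := by
  have hb (n : ℕ) : ‖(n : 𝕜)⁻¹ * ∑ j ∈ Finset.range n, a j
      - (n : 𝕜)⁻¹ * ∑ j ∈ Finset.range n, a (k + j)‖ ≤ (2 * (k * C)) * (n : ℝ)⁻¹ := by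
    have e : ∑ j ∈ Finset.range n, a j - ∑ j ∈ Finset.range n, a (k + j)
        = ∑ j ∈ Finset.range k, a j - ∑ j ∈ Finset.range k, a (n + j) := by
      rw [sub_eq_sub_iff_add_eq_add, ← Finset.sum_range_add, ← Finset.sum_range_add, add_comm]
    rw [← mul_sub, e, norm_mul, norm_inv, RCLike.norm_natCast, mul_comm]
    gcongr
    refine (norm_sub_le _ _).trans ?_
    rw [two_mul]
    refine add_le_add ?_ ?_ <;>
    · refine (norm_sum_le_of_le _ fun j _ => ha _).trans ?_
      simp
  refine squeeze_zero_norm hb ?_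
  simpa using tendsto_inv_atTop_nhds_zero_nat.const_mul (2 * (k * C) : ℝ)

/-- Pointwise ergodic theorem for bounded functions. Up to the `L¹`-small term `A_N F - h`, the
function `F` is `(F - A_N F) + h`; the averages of the first part telescope and `h` is invariant. -/
lemma ae_tendsto_kernelAvg_of_bounded [IsMarkovKernel Q] [IsProbabilityMeasure ρ]
    (hQ : Kernel.Invariant Q ρ) {F h : Z → 𝕜} (hF : StronglyMeasurable F) {C : ℝ}
    (hC : ∀ z, ‖F z‖ ≤ C) (hC0 : 0 ≤ C) (hh : StronglyMeasurable h) (hhi : Integrable h ρ)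
    (hinv : ∀ᵐ z ∂ρ, ∀ᵐ w ∂(Q z), h w = h z)
    (hlim : Tendsto (fun n => eLpNorm (kernelAvg Q F n - h) 1 ρ) atTop (𝓝 0)) :
    ∀ᵐ z ∂ρ, Tendsto (fun n => kernelAvg Q F n z) atTop (𝓝 (h z)) := by
  have hAm (N : ℕ) : StronglyMeasurable (kernelAvg Q F N) := stronglyMeasurable_kernelAvg hF N
  have hAb (N : ℕ) (z : Z) : ‖kernelAvg Q F N z‖ ≤ C := norm_kernelAvg_le hC hC0 N z
  have hAint (N j : ℕ) (z : Z) : Integrable (kernelAvg Q F N) ((Q ^ j) z) :=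
    integrable_pow_of_bounded (hAm N) (hAb N) j z
  have hFi (j : ℕ) (z : Z) : Integrable F ((Q ^ j) z) := integrable_pow_of_bounded hF hC j z
  have hFiρ : Integrable F ρ := Integrable.of_bound hF.aestronglyMeasurable C (ae_of_all _ hC)
  have hAiρ (N : ℕ) : Integrable (kernelAvg Q F N) ρ :=
    Integrable.of_bound (hAm N).aestronglyMeasurable C (ae_of_all _ (hAb N))
  refine ae_tendsto_kernelAvg_of_approx hQ hF hFiρ hh
    (Fs := fun N => (F - kernelAvg Q F (N + 1)) + h) (hs := fun _ => h)
    (fun N => (hF.sub (hAm _)).add hh) (fun N => (hFiρ.sub (hAiρ _)).add hhi) (fun _ => hh)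
    ?_ (by simp) fun N => ?_
  · refine (hlim.comp (tendsto_add_atTop_nat 1)).congr fun N => ?_
    simp only [Function.comp]
    congr 1
    ext z
    simp only [Pi.sub_apply, Pi.add_apply]
    ring
  · filter_upwards [ae_forall_integrable_pow hQ hhi, ae_kernelAvg_eq_self hQ hh hinv] with z hz1 hz2
    have hzero : Tendsto (fun n => kernelAvg Q (F - kernelAvg Q F (N + 1)) n z) atTop (𝓝 0) := by
      set a : ℕ → 𝕜 := fun j => ∫ w, F w ∂((Q ^ j) z) with ha
      have hshift (j k : ℕ) : ∫ w, ∫ v, F v ∂((Q ^ k) w) ∂((Q ^ j) z) = a (k + j) := by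
        rw [ha]
        simp only
        rw [pow_add]
        exact (Kernel.integral_comp (η := Q ^ k) (κ := Q ^ j)
          (by rw [← Kernel.pow_add]; exact hFi (k + j) z)).symm
      have hAN (j : ℕ) : ∫ w, kernelAvg Q F (N + 1) w ∂((Q ^ j) z)
          = ((N + 1 : ℕ) : 𝕜)⁻¹ * ∑ k ∈ Finset.range (N + 1), a (k + j) := by
        simp only [kernelAvg]
        rw [integral_const_mul, integral_finsetSum _ fun k _ =>
          integrable_pow_of_bounded (stronglyMeasurable_integral_pow hF k)
            (norm_integral_pow_le hC k) j z]
        simp only [hshift]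
      have hN : ((N + 1 : ℕ) : 𝕜) ≠ 0 := by exact_mod_cast N.succ_ne_zero
      -- With `a j = Qʲ F z`, the averages of `F - A_{N+1} F` are means over `k ≤ N` of differences
      -- between the averages of `a` and those of its shift by `k`.
      have hdecomp (n : ℕ) : kernelAvg Q (F - kernelAvg Q F (N + 1)) n z
          = ((N + 1 : ℕ) : 𝕜)⁻¹ * ∑ k ∈ Finset.range (N + 1),
            ((n : 𝕜)⁻¹ * ∑ j ∈ Finset.range n, a j
              - (n : 𝕜)⁻¹ * ∑ j ∈ Finset.range n, a (k + j)) := by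
        rw [kernelAvg_sub (fun j => hFi j z) (fun j => hAint _ j z), Finset.sum_sub_distrib,
          mul_sub]
        congr 1
        · rw [Finset.sum_const, Finset.card_range, nsmul_eq_mul, inv_mul_cancel_left₀ hN]
          rfl
        · rw [kernelAvg, Finset.sum_congr rfl fun j _ => hAN j, ← Finset.mul_sum, ← Finset.mul_sum,
            Finset.sum_comm]
          ring
      simp only [hdecomp]
      have := (tendsto_finsetSum (Finset.range (N + 1)) fun k _ =>
        tendsto_average_sub_shift (a := a) (norm_integral_pow_le hC · z) k).const_mul
          (((N + 1 : ℕ) : 𝕜)⁻¹)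
      simpa using this
    have h3 : Tendsto (fun n => kernelAvg Q (F - kernelAvg Q F (N + 1)) n z + h z) atTop
        (𝓝 (h z)) := by simpa using hzero.add_const (h z)
    refine h3.congr' ?_
    filter_upwards [eventually_ne_atTop 0] with n hn
    rw [kernelAvg_add (fun j => (hFi j z).sub (hAint _ j z)) hz1, hz2 n hn]

lemma eLpNorm_limit_sub_le [IsMarkovKernel Q] (hQ : Kernel.Invariant Q ρ) {F G h h' : Z → 𝕜}
    (hF : StronglyMeasurable F) (hG : StronglyMeasurable G) (hFi : Integrable F ρ)
    (hGi : Integrable G ρ) (hh : StronglyMeasurable h) (hh' : StronglyMeasurable h')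
    (hlim : Tendsto (fun n => eLpNorm (kernelAvg Q F n - h) 1 ρ) atTop (𝓝 0))
    (hlim' : Tendsto (fun n => eLpNorm (kernelAvg Q G n - h') 1 ρ) atTop (𝓝 0)) :
    eLpNorm (h - h') 1 ρ ≤ eLpNorm (F - G) 1 ρ := by
  have h1 (n : ℕ) : eLpNorm (h - h') 1 ρ ≤ eLpNorm (F - G) 1 ρ
      + (eLpNorm (kernelAvg Q F n - h) 1 ρ + eLpNorm (kernelAvg Q G n - h') 1 ρ) := by
    have e : h - h' = (kernelAvg Q F n - kernelAvg Q G n)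
        + (-(kernelAvg Q F n - h) + (kernelAvg Q G n - h')) := by abel
    have mF := (stronglyMeasurable_kernelAvg (Q := Q) hF n).aestronglyMeasurable (μ := ρ)
    have mG := (stronglyMeasurable_kernelAvg (Q := Q) hG n).aestronglyMeasurable (μ := ρ)
    have mh := hh.aestronglyMeasurable (μ := ρ)
    have mh' := hh'.aestronglyMeasurable (μ := ρ)
    rw [e]
    refine (eLpNorm_add_le (mF.sub mG) ((mF.sub mh).neg.add (mG.sub mh')) le_rfl).trans ?_
    refine add_le_add (eLpNorm_kernelAvg_sub_le hQ hF hG hFi hGi n) ?_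
    refine (eLpNorm_add_le (mF.sub mh).neg (mG.sub mh') le_rfl).trans ?_
    rw [eLpNorm_neg]
  have h2 := (hlim.add hlim').const_add (eLpNorm (F - G) 1 ρ)
  rw [add_zero, add_zero] at h2
  exact ge_of_tendsto' h2 h1

lemma exists_bounded_approx [IsFiniteMeasure ρ] {F : Z → 𝕜} (hFi : Integrable F ρ) :
    ∃ Fs : ℕ → Z → 𝕜, ∃ C : ℕ → ℝ, ∀ k, StronglyMeasurable (Fs k) ∧ 0 ≤ C k ∧
      (∀ z, ‖Fs k z‖ ≤ C k) ∧ Integrable (Fs k) ρ ∧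
      eLpNorm (F - Fs k) 1 ρ < ((2 : ℝ≥0∞)⁻¹) ^ k := by
  have h1 (k : ℕ) : ∃ G : Z → 𝕜, ∃ C : ℝ, StronglyMeasurable G ∧ 0 ≤ C ∧ (∀ z, ‖G z‖ ≤ C) ∧
      Integrable G ρ ∧ eLpNorm (F - G) 1 ρ < ((2 : ℝ≥0∞)⁻¹) ^ k := by
    have hpos : ((2 : ℝ≥0∞)⁻¹) ^ k ≠ 0 := by simp
    obtain ⟨S, hS, hSi⟩ :=
      (memLp_one_iff_integrable.2 hFi).exists_simpleFunc_eLpNorm_sub_lt (by simp) hpos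
    obtain ⟨C, hC⟩ := S.exists_forall_norm_le
    exact ⟨S, max C 0, S.stronglyMeasurable, le_max_right _ _,
      fun z => (hC z).trans (le_max_left _ _), memLp_one_iff_integrable.1 hSi, hS⟩
  choose Fs C h using h1
  exact ⟨Fs, C, h⟩

lemma tendsto_eLpNorm_kernelAvg_of_approx [IsMarkovKernel Q] (hQ : Kernel.Invariant Q ρ)
    {F h : Z → 𝕜} {Fs hs : ℕ → Z → 𝕜} (hF : StronglyMeasurable F) (hFi : Integrable F ρ)
    (hh : StronglyMeasurable h) (hFs : ∀ k, StronglyMeasurable (Fs k))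
    (hFsi : ∀ k, Integrable (Fs k) ρ) (hhs : ∀ k, StronglyMeasurable (hs k))
    (hFlim : Tendsto (fun k => eLpNorm (F - Fs k) 1 ρ) atTop (𝓝 0))
    (hhlim : Tendsto (fun k => eLpNorm (hs k - h) 1 ρ) atTop (𝓝 0))
    (hconv : ∀ k, Tendsto (fun n => eLpNorm (kernelAvg Q (Fs k) n - hs k) 1 ρ) atTop (𝓝 0)) :
    Tendsto (fun n => eLpNorm (kernelAvg Q F n - h) 1 ρ) atTop (𝓝 0) := by
  rw [ENNReal.tendsto_nhds_zero]
  intro ε hε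
  have h2 := hFlim.add hhlim
  rw [add_zero] at h2
  obtain ⟨k, hk⟩ := (ENNReal.tendsto_nhds_zero.1 h2 (ε / 2) (ENNReal.half_pos hε.ne')).exists
  filter_upwards [ENNReal.tendsto_nhds_zero.1 (hconv k) (ε / 2) (ENNReal.half_pos hε.ne')]
    with n hn
  have e : kernelAvg Q F n - h = (kernelAvg Q F n - kernelAvg Q (Fs k) n)
      + ((hs k - h) + (kernelAvg Q (Fs k) n - hs k)) := by abel
  have mF := (stronglyMeasurable_kernelAvg (Q := Q) hF n).aestronglyMeasurable (μ := ρ)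
  have mG := (stronglyMeasurable_kernelAvg (Q := Q) (hFs k) n).aestronglyMeasurable (μ := ρ)
  have mh := hh.aestronglyMeasurable (μ := ρ)
  have mh' := (hhs k).aestronglyMeasurable (μ := ρ)
  calc eLpNorm (kernelAvg Q F n - h) 1 ρ
      ≤ eLpNorm (F - Fs k) 1 ρ + (eLpNorm (hs k - h) 1 ρ
        + eLpNorm (kernelAvg Q (Fs k) n - hs k) 1 ρ) := by
        rw [e]
        refine (eLpNorm_add_le (mF.sub mG) ((mh'.sub mh).add (mG.sub mh')) le_rfl).trans ?_
        exact add_le_add (eLpNorm_kernelAvg_sub_le hQ hF (hFs k) hFi (hFsi k) n)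
          (eLpNorm_add_le (mh'.sub mh) (mG.sub mh') le_rfl)
    _ ≤ ε / 2 + ε / 2 := by rw [← add_assoc]; exact add_le_add hk hn
    _ = ε := ENNReal.add_halves ε

/-- Being constant along the transitions of the chain is preserved under `L¹` limits. -/
lemma ae_ae_eq_of_L1_limit [IsMarkovKernel Q] (hQ : Kernel.Invariant Q ρ)
    {h : Z → 𝕜} {hs : ℕ → Z → 𝕜} (hh : StronglyMeasurable h) (hhs : ∀ k, StronglyMeasurable (hs k))
    (hinv : ∀ k, ∀ᵐ z ∂ρ, ∀ᵐ w ∂(Q z), hs k w = hs k z)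
    (hhlim : Tendsto (fun k => eLpNorm (hs k - h) 1 ρ) atTop (𝓝 0)) :
    ∀ᵐ z ∂ρ, ∀ᵐ w ∂(Q z), h w = h z := by
  have hmeas : Measurable fun p : Z × Z => ‖h p.2 - h p.1‖ₑ :=
    ((hh.comp_measurable measurable_snd).sub (hh.comp_measurable measurable_fst)).enorm
  have hle (k : ℕ) : ∫⁻ z, ∫⁻ w, ‖h w - h z‖ₑ ∂(Q z) ∂ρ
      ≤ eLpNorm (hs k - h) 1 ρ + eLpNorm (hs k - h) 1 ρ := by
    have hd : Measurable fun z => ‖(hs k - h) z‖ₑ := ((hhs k).sub hh).enorm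
    calc ∫⁻ z, ∫⁻ w, ‖h w - h z‖ₑ ∂(Q z) ∂ρ
        ≤ ∫⁻ z, ((∫⁻ w, ‖(hs k - h) w‖ₑ ∂(Q z)) + ‖(hs k - h) z‖ₑ) ∂ρ := by
          refine lintegral_mono_ae ?_
          filter_upwards [hinv k] with z hz
          have e2 : ‖(hs k - h) z‖ₑ = ∫⁻ _w, ‖(hs k - h) z‖ₑ ∂(Q z) := by simp
          rw [e2, ← lintegral_add_left hd]
          refine lintegral_mono_ae ?_
          filter_upwards [hz] with w hw
          have e3 : h w - h z = -((hs k - h) w) + (hs k - h) z := by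
            simp only [Pi.sub_apply, hw]; ring
          rw [e3]
          exact (enorm_add_le _ _).trans (by rw [enorm_neg])
      _ = _ := by
          rw [lintegral_add_right _ hd, lintegral_lintegral_kernel hQ hd,
            eLpNorm_one_eq_lintegral_enorm]
  have h2 := hhlim.add hhlim
  rw [add_zero] at h2
  have h3 : ∫⁻ z, ∫⁻ w, ‖h w - h z‖ₑ ∂(Q z) ∂ρ = 0 :=
    nonpos_iff_eq_zero.1 (ge_of_tendsto' h2 hle)
  rw [lintegral_eq_zero_iff hmeas.lintegral_kernel_prod_right'] at h3
  filter_upwards [h3] with z hz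
  have hz' : ∫⁻ w, ‖h w - h z‖ₑ ∂(Q z) = 0 := hz
  have hmz : Measurable fun w => ‖h w - h z‖ₑ := (hh.sub stronglyMeasurable_const).enorm
  rw [lintegral_eq_zero_iff hmz] at hz'
  filter_upwards [hz'] with w hw
  simpa [sub_eq_zero] using hw

/-- The ergodic theorem for a Markov kernel with invariant probability measure: the averages of an
integrable function converge in `L¹` and almost everywhere, the limit is constant along the
transitions of the chain, and it has the same integral as the function over sets that the chain
neither enters nor leaves. -/
theorem exists_kernelAvg_tendsto [IsMarkovKernel Q] [IsProbabilityMeasure ρ]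
    (hQ : Kernel.Invariant Q ρ) {F : Z → 𝕜} (hF : StronglyMeasurable F) (hFi : Integrable F ρ) :
    ∃ h : Z → 𝕜, StronglyMeasurable h ∧ Integrable h ρ ∧
      (∀ᵐ z ∂ρ, ∀ᵐ w ∂(Q z), h w = h z) ∧
      Tendsto (fun n => eLpNorm (kernelAvg Q F n - h) 1 ρ) atTop (𝓝 0) ∧
      (∀ᵐ z ∂ρ, Tendsto (fun n => kernelAvg Q F n z) atTop (𝓝 (h z))) ∧
      ∀ A : Set Z, MeasurableSet A → (∀ᵐ z ∂ρ, ∀ᵐ w ∂(Q z), w ∈ A ↔ z ∈ A) →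
        ∫ z in A, h z ∂ρ = ∫ z in A, F z ∂ρ := by
  obtain ⟨S, C, hSC⟩ := exists_bounded_approx hFi
  choose hSm hC0 hC hSi hS using hSC
  choose hs hsm hsi hsinv hslim using fun k =>
    exists_kernelAvg_tendsto_of_bounded hQ (hSm k) (hC k) (hC0 k)
  have hcau (N n m : ℕ) (hn : N ≤ n) (hm : N ≤ m) :
      eLpNorm (hs n - hs m) 1 ρ < 2 * ((2 : ℝ≥0∞)⁻¹) ^ N := by
    refine (eLpNorm_limit_sub_le hQ (hSm n) (hSm m) (hSi n) (hSi m) (hsm n) (hsm m)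
      (hslim n) (hslim m)).trans_lt ?_
    have e : S n - S m = -(F - S n) + (F - S m) := by abel
    have m1 := (hF.sub (hSm n)).aestronglyMeasurable (μ := ρ)
    have m2 := (hF.sub (hSm m)).aestronglyMeasurable (μ := ρ)
    rw [e]
    refine (eLpNorm_add_le m1.neg m2 le_rfl).trans_lt ?_
    rw [eLpNorm_neg, two_mul]
    have hle (j : ℕ) (hj : N ≤ j) : ((2 : ℝ≥0∞)⁻¹) ^ j ≤ ((2 : ℝ≥0∞)⁻¹) ^ N :=
      pow_le_pow_right_of_le_one' (by simp) hj
    exact ENNReal.add_lt_add ((hS n).trans_le (hle n hn)) ((hS m).trans_le (hle m hm))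
  have hsum : ∑' N : ℕ, 2 * ((2 : ℝ≥0∞)⁻¹) ^ N ≠ ∞ := by
    rw [ENNReal.tsum_mul_left, ENNReal.tsum_geometric_two]
    exact ENNReal.mul_ne_top (by simp) (by simp)
  obtain ⟨h0, hh0, hh0lim⟩ := Lp.cauchy_complete_eLpNorm le_rfl
    (fun k => memLp_one_iff_integrable.2 (hsi k)) hsum hcau
  obtain ⟨h, hhm, hae⟩ := hh0.1
  have hhi : Integrable h ρ := (memLp_one_iff_integrable.1 hh0).congr hae
  have hhlim : Tendsto (fun k => eLpNorm (hs k - h) 1 ρ) atTop (𝓝 0) :=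
    hh0lim.congr fun k => eLpNorm_congr_ae (EventuallyEq.rfl.sub hae)
  have hSlim : Tendsto (fun k => eLpNorm (F - S k) 1 ρ) atTop (𝓝 0) :=
    tendsto_of_tendsto_of_tendsto_of_le_of_le tendsto_const_nhds
      (ENNReal.tendsto_pow_atTop_nhds_zero_of_lt_one (by simp)) (fun _ => zero_le)
      fun k => (hS k).le
  have hL1 := tendsto_eLpNorm_kernelAvg_of_approx hQ hF hFi hhm hSm hSi hsm hSlim hhlim hslim
  refine ⟨h, hhm, hhi, ae_ae_eq_of_L1_limit hQ hhm hsm hsinv hhlim, hL1,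
    ae_tendsto_kernelAvg_of_approx hQ hF hFi hhm hSm hSi hsm hSlim hhlim fun k =>
      ae_tendsto_kernelAvg_of_bounded hQ (hSm k) (hC k) (hC0 k) (hsm k) (hsi k) (hsinv k) (hslim k),
    fun A hA hAinv => ?_⟩
  have hAvg (n : ℕ) : Integrable (kernelAvg Q F n) ρ :=
    memLp_one_iff_integrable.1 ⟨(stronglyMeasurable_kernelAvg hF n).aestronglyMeasurable,
      (eLpNorm_kernelAvg_le hQ hF n).trans_lt (memLp_one_iff_integrable.2 hFi).2⟩
  have ht := tendsto_setIntegral_of_L1' h hhi.1 (Eventually.of_forall hAvg) hL1 A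
  refine tendsto_nhds_unique ht (tendsto_const_nhds.congr' ?_)
  filter_upwards [eventually_ne_atTop 0] with n hn
  exact (setIntegral_kernelAvg hQ hFi hA hAinv hn).symm

end PointwiseErgodic

section Paths

/-! ### Random compositions along a path -/

lemma measurePreserving_randomIterate {E X : Type*} [MeasurableSpace X] {μ : Measure X}
    {T : E → X → X} (hTμ : ∀ y, MeasurePreserving (T y) μ μ) (ω : ℕ → E) (n : ℕ) :
    MeasurePreserving (randomIterate T ω n) μ μ := by
  induction n with
  | zero => exact MeasurePreserving.id μ
  | succ n ih => exact (hTμ (ω n)).comp ih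

lemma randomIterate_congr {E X : Type*} (T : E → X → X) {ω ω' : ℕ → E} {n : ℕ}
    (h : ∀ i < n, ω i = ω' i) :
    randomIterate T ω n = randomIterate T ω' n := by
  induction n with
  | zero => rfl
  | succ n ih =>
    simp only [randomIterate]
    rw [ih fun i hi => h i (hi.trans n.lt_succ_self), h n n.lt_succ_self]

/-- Extension of a path of length `n + 1` to an infinite path, constant after time `n`. -/
def extendPath {E : Type*} (n : ℕ) (r : Finset.Iic n → E) (i : ℕ) : E :=
  r ⟨min i n, Finset.mem_Iic.2 (min_le_right i n)⟩

lemma extendPath_frestrictLe {E : Type*} {n i : ℕ} (hi : i ≤ n) (ω : ℕ → E) :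
    extendPath n (Preorder.frestrictLe (π := fun _ => E) n ω) i = ω i := by
  simp [extendPath, hi]

end Paths

section SkewChain

variable {E X 𝕜 : Type*} [MeasurableSpace E] [MeasurableSpace X] [RCLike 𝕜]

/-! ### The chain on the product space -/

/-- The kernel on `E × X` that moves `(y, x)` to `(y', T_y x)` with `y'` drawn from `π(y, ·)`. -/
noncomputable def skewKernel (π : Kernel E E) (T : E → X → X)
    (hT : Measurable (fun p : E × X => T p.1 p.2)) : Kernel (E × X) (E × X) :=
  (π.comap Prod.fst measurable_fst) ×ₖ (Kernel.deterministic (fun p : E × X => T p.1 p.2) hT)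

variable {π : Kernel E E} [IsMarkovKernel π] {m : Measure E} {μ : Measure X}
  {T : E → X → X} {hT : Measurable (fun p : E × X => T p.1 p.2)}

instance instIsMarkovKernelSkewKernel : IsMarkovKernel (skewKernel π T hT) := by
  unfold skewKernel; infer_instance

lemma skewKernel_apply (z : E × X) :
    skewKernel π T hT z = (π z.1).map fun y' => (y', T z.1 z.2) := by
  rw [skewKernel, Kernel.prod_apply, Kernel.comap_apply, Kernel.deterministic_apply,
    Measure.prod_dirac]

lemma lintegral_skewKernel {F : E × X → ℝ≥0∞} (hF : Measurable F) (z : E × X) :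
    ∫⁻ w, F w ∂(skewKernel π T hT z) = ∫⁻ y', F (y', T z.1 z.2) ∂(π z.1) := by
  rw [skewKernel_apply, lintegral_map hF (by fun_prop)]

lemma ae_skewKernel_iff {p : E × X → Prop} (hp : MeasurableSet {w | p w}) (z : E × X) :
    (∀ᵐ w ∂(skewKernel π T hT z), p w) ↔ ∀ᵐ y' ∂(π z.1), p (y', T z.1 z.2) := by
  rw [skewKernel_apply, ae_map_iff (by fun_prop) hp]

lemma invariant_skewKernel [IsProbabilityMeasure m] [IsProbabilityMeasure μ]
    (hm : Kernel.Invariant π m) (hTμ : ∀ y, MeasurePreserving (T y) μ μ) :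
    Kernel.Invariant (skewKernel π T hT) (m.prod μ) := by
  refine Measure.ext_of_lintegral _ fun F hF => ?_
  rw [Measure.lintegral_bind (Kernel.aemeasurable _) hF.aemeasurable,
    lintegral_prod _ hF.lintegral_kernel.aemeasurable, lintegral_prod _ hF.aemeasurable]
  have hG : Measurable fun y' => ∫⁻ x, F (y', x) ∂μ := hF.lintegral_prod_right'
  calc ∫⁻ y, ∫⁻ x, ∫⁻ w, F w ∂(skewKernel π T hT (y, x)) ∂μ ∂m
      = ∫⁻ y, ∫⁻ y', ∫⁻ x, F (y', x) ∂μ ∂(π y) ∂m := by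
        refine lintegral_congr fun y => ?_
        have hTy : Measurable fun p : X × E => F (p.2, T y p.1) :=
          hF.comp (measurable_snd.prodMk ((hTμ y).measurable.comp measurable_fst))
        simp only [lintegral_skewKernel hF]
        rw [lintegral_lintegral_swap hTy.aemeasurable]
        refine lintegral_congr fun y' => ?_
        exact (hTμ y).lintegral_comp (hF.comp measurable_prodMk_left)
    _ = ∫⁻ y, ∫⁻ x, F (y, x) ∂μ ∂m := lintegral_lintegral_kernel hm hG

/-! ### The law of the chain driven by the Markov measure -/

lemma measurable_randomIterate (hT : Measurable (fun p : E × X => T p.1 p.2)) (n : ℕ) :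
    Measurable fun p : (ℕ → E) × X => randomIterate T p.1 n p.2 := by
  induction n with
  | zero => exact measurable_snd
  | succ n ih =>
    exact hT.comp (((measurable_pi_apply n).comp measurable_fst).prodMk ih)

lemma measurable_extendPath (n : ℕ) : Measurable (extendPath (E := E) n) :=
  measurable_pi_lambda _ fun _ => measurable_pi_apply _

instance instIsProbabilityMeasureMarkovMeasure [IsProbabilityMeasure m] :
    IsProbabilityMeasure (markovMeasure π m) := by
  unfold markovMeasure; infer_instance

lemma markovMeasure_map_zero [IsProbabilityMeasure m] :
    (markovMeasure π m).map (fun ω => ω 0) = m := by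
  have h1 : (markovMeasure π m).map (Preorder.frestrictLe (π := fun _ => E) 0)
      = m.map (MeasurableEquiv.piUnique (fun _ : Finset.Iic 0 => E)).symm := by
    rw [markovMeasure, Kernel.trajMeasure, Measure.map_comp _ _ (by fun_prop),
      Kernel.traj_map_frestrictLe, Kernel.partialTraj_self]
    exact Measure.id_comp
  have h2 : (fun ω : ℕ → E => ω 0)
      = (fun r : Finset.Iic 0 → E => r ⟨0, Finset.mem_Iic.2 le_rfl⟩)
        ∘ (Preorder.frestrictLe (π := fun _ => E) 0) := rfl
  rw [h2, ← Measure.map_map (by fun_prop) (by fun_prop), h1,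
    Measure.map_map (by fun_prop) (by fun_prop)]
  exact Measure.map_id

/-- The Markov property: given the path up to time `n`, the pair `(ω (n + 1), T_ω^{n + 1} x)` is
obtained from `(ω n, T_ω^n x)` by one step of the chain on `E × X`. -/
lemma lintegral_markovMeasure_succ [IsProbabilityMeasure m] (n : ℕ) (x : X)
    {F : E × X → ℝ≥0∞} (hF : Measurable F) :
    ∫⁻ ω, F (ω (n + 1), randomIterate T ω (n + 1) x) ∂(markovMeasure π m)
      = ∫⁻ ω, ∫⁻ w, F w ∂(skewKernel π T hT (ω n, randomIterate T ω n x))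
          ∂(markovMeasure π m) := by
  set R : (ℕ → E) → (Finset.Iic n → E) := Preorder.frestrictLe (π := fun _ => E) n
  have hR : Measurable R := by fun_prop
  have hlaw : (markovMeasure π m).map R ⊗ₘ stepKernel π n
      = (markovMeasure π m).map fun ω => (R ω, ω (n + 1)) :=
    Kernel.map_frestrictLe_trajMeasure_compProd_eq_map_trajMeasure
  have hΦ : Measurable fun r : Finset.Iic n → E => randomIterate T (extendPath n r) n x :=
    (measurable_randomIterate hT n).comp ((measurable_extendPath n).prodMk measurable_const)
  have hlast : Measurable fun r : Finset.Iic n → E => r ⟨n, Finset.mem_Iic.2 le_rfl⟩ :=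
    measurable_pi_apply _
  set G : (Finset.Iic n → E) × E → ℝ≥0∞ := fun q =>
    F (q.2, T (q.1 ⟨n, Finset.mem_Iic.2 le_rfl⟩) (randomIterate T (extendPath n q.1) n x))
  have hG : Measurable G := hF.comp (measurable_snd.prodMk
    (hT.comp ((hlast.comp measurable_fst).prodMk (hΦ.comp measurable_fst))))
  have hpath (ω : ℕ → E) : randomIterate T (extendPath n (R ω)) n x = randomIterate T ω n x :=
    congrFun (randomIterate_congr T fun i hi => extendPath_frestrictLe hi.le ω) x
  calc ∫⁻ ω, F (ω (n + 1), randomIterate T ω (n + 1) x) ∂(markovMeasure π m)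
      = ∫⁻ ω, G (R ω, ω (n + 1)) ∂(markovMeasure π m) := by
        refine lintegral_congr fun ω => ?_
        simp only [G, hpath]
        rfl
    _ = ∫⁻ q, G q ∂((markovMeasure π m).map R ⊗ₘ stepKernel π n) := by
        rw [hlaw, lintegral_map hG (by fun_prop)]
    _ = ∫⁻ ω, ∫⁻ y, G (R ω, y) ∂(stepKernel π n (R ω)) ∂(markovMeasure π m) := by
        rw [Measure.lintegral_compProd hG, lintegral_map hG.lintegral_kernel_prod_right' hR]
    _ = _ := by
        refine lintegral_congr fun ω => ?_
        rw [lintegral_skewKernel hF]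
        simp only [G, hpath]
        rfl

/-- The law of `(ω n, T_ω^n x)` under the Markov measure is the `n`-th step of the chain on `E × X`
started from `m ⊗ δ_x`. -/
lemma markovMeasure_map_eq [IsProbabilityMeasure m] (n : ℕ) (x : X) :
    (markovMeasure π m).map (fun ω => (ω n, randomIterate T ω n x))
      = (skewKernel π T hT ^ n : Kernel (E × X) (E × X)) ∘ₘ (m.map fun y => (y, x)) := by
  have hmeas (n : ℕ) : Measurable fun ω : ℕ → E => (ω n, randomIterate T ω n x) :=
    (measurable_pi_apply n).prodMk ((measurable_randomIterate hT n).comp measurable_prodMk_right)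
  refine Measure.ext_of_lintegral _ fun F hF => ?_
  rw [lintegral_map hF (hmeas n)]
  induction n generalizing F with
  | zero =>
    have h1 : (skewKernel π T hT ^ 0 : Kernel (E × X) (E × X)) ∘ₘ (m.map fun y => (y, x))
        = m.map fun y => (y, x) :=
      Measure.id_comp
    have h2 : Measurable fun y => F (y, x) := hF.comp measurable_prodMk_right
    rw [h1, lintegral_map hF (by fun_prop)]
    conv_rhs => rw [← markovMeasure_map_zero (π := π) (m := m)]
    rw [lintegral_map h2 (by fun_prop)]
    rfl
  | succ n ih =>
    have h1 : (skewKernel π T hT ^ (n + 1) : Kernel (E × X) (E × X)) ∘ₘ (m.map fun y => (y, x))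
        = skewKernel π T hT ∘ₘ ((skewKernel π T hT ^ n : Kernel (E × X) (E × X)) ∘ₘ
        (m.map fun y => (y, x))) := by
      rw [Measure.comp_assoc, pow_succ']; rfl
    rw [lintegral_markovMeasure_succ (hT := hT) n x hF, ih _ hF.lintegral_kernel, h1,
      Measure.lintegral_bind (Kernel.aemeasurable _) hF.aemeasurable]

/-! ### Expectation operators and kernel averages -/

section Expectation

variable [IsProbabilityMeasure m] [IsProbabilityMeasure μ]

lemma lintegral_lintegral_randomIterate (hT : Measurable (fun p : E × X => T p.1 p.2))
    (hTμ : ∀ y, MeasurePreserving (T y) μ μ) (n : ℕ) {F : X → ℝ≥0∞} (hF : Measurable F) :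
    ∫⁻ x, ∫⁻ ω, F (randomIterate T ω n x) ∂(markovMeasure π m) ∂μ = ∫⁻ x, F x ∂μ := by
  have h1 : Measurable fun p : X × (ℕ → E) => F (randomIterate T p.2 n p.1) :=
    hF.comp ((measurable_randomIterate hT n).comp measurable_swap)
  rw [lintegral_lintegral_swap h1.aemeasurable]
  simp [(measurePreserving_randomIterate hTμ _ n).lintegral_comp hF]

lemma ae_ae_randomIterate (hT : Measurable (fun p : E × X => T p.1 p.2))
    (hTμ : ∀ y, MeasurePreserving (T y) μ μ) {p : X → Prop} (hp : ∀ᵐ x ∂μ, p x) :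
    ∀ᵐ x ∂μ, ∀ n : ℕ, ∀ᵐ ω ∂(markovMeasure π m), p (randomIterate T ω n x) := by
  refine ae_all_iff.2 fun n => ?_
  set N := toMeasurable μ {x | ¬ p x}
  have hN : MeasurableSet N := measurableSet_toMeasurable _ _
  have hN0 : μ N = 0 := (measure_toMeasurable _).trans (ae_iff.1 hp)
  have h1 := lintegral_lintegral_randomIterate (π := π) (m := m) hT hTμ n
    (measurable_one.indicator hN : Measurable (N.indicator (1 : X → ℝ≥0∞)))
  rw [lintegral_indicator_one hN, hN0] at h1
  have hj : Measurable fun q : X × (ℕ → E) =>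
      N.indicator (1 : X → ℝ≥0∞) (randomIterate T q.2 n q.1) :=
    (measurable_one.indicator hN).comp ((measurable_randomIterate hT n).comp measurable_swap)
  rw [lintegral_eq_zero_iff hj.lintegral_prod_right'] at h1
  filter_upwards [h1] with x hx
  have hjx : Measurable fun ω : ℕ → E =>
      N.indicator (1 : X → ℝ≥0∞) (randomIterate T ω n x) := hj.comp measurable_prodMk_left
  have hx' : ∫⁻ ω, N.indicator (1 : X → ℝ≥0∞) (randomIterate T ω n x) ∂(markovMeasure π m) = 0 := hx
  rw [lintegral_eq_zero_iff hjx] at hx'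
  filter_upwards [hx'] with ω hω
  by_contra hcon
  have : randomIterate T ω n x ∈ N := subset_toMeasurable _ _ hcon
  simp [this] at hω

lemma ae_integrable_randomIterate (hT : Measurable (fun p : E × X => T p.1 p.2))
    (hTμ : ∀ y, MeasurePreserving (T y) μ μ) {f : X → 𝕜} (hf : StronglyMeasurable f)
    (hfi : Integrable f μ) :
    ∀ᵐ x ∂μ, ∀ n : ℕ, Integrable (fun ω => f (randomIterate T ω n x)) (markovMeasure π m) := by
  refine ae_all_iff.2 fun n => ?_
  have h1 := lintegral_lintegral_randomIterate (π := π) (m := m) hT hTμ n hf.enorm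
  have hj : Measurable fun q : X × (ℕ → E) => ‖f (randomIterate T q.2 n q.1)‖ₑ :=
    hf.enorm.comp ((measurable_randomIterate hT n).comp measurable_swap)
  have h2 := ae_lt_top hj.lintegral_prod_right' (ne_of_eq_of_ne h1 hfi.2.ne)
  filter_upwards [h2] with x hx
  exact ⟨(hf.comp_measurable
    ((measurable_randomIterate hT n).comp measurable_prodMk_right)).aestronglyMeasurable, hx⟩

lemma expectationOp_eq_integral_pow {f : X → 𝕜} (hf : StronglyMeasurable f) {x : X} {n : ℕ}
    (hx : Integrable (fun ω => f (randomIterate T ω n x)) (markovMeasure π m)) :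
    Integrable (fun y => ∫ w, f w.2 ∂((skewKernel π T hT ^ n) (y, x))) m ∧
    expectationOp (markovMeasure π m) T n f x
      = ∫ y, ∫ w, f w.2 ∂((skewKernel π T hT ^ n) (y, x)) ∂m := by
  have hmeas : Measurable fun ω : ℕ → E => (ω n, randomIterate T ω n x) :=
    (measurable_pi_apply n).prodMk ((measurable_randomIterate hT n).comp measurable_prodMk_right)
  have hF : StronglyMeasurable fun w : E × X => f w.2 := hf.comp_measurable measurable_snd
  have hpair : Measurable fun y : E => (y, x) := measurable_prodMk_right
  have h1 : Integrable (fun w : E × X => f w.2)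
      ((skewKernel π T hT ^ n : Kernel (E × X) (E × X)) ∘ₘ
        (m.map fun y => (y, x))) := by
    rw [← markovMeasure_map_eq, integrable_map_measure hF.aestronglyMeasurable hmeas.aemeasurable]
    exact hx
  have h2 : expectationOp (markovMeasure π m) T n f x
      = ∫ w, f w.2 ∂((skewKernel π T hT ^ n : Kernel (E × X) (E × X)) ∘ₘ
        (m.map fun y => (y, x))) := by
    rw [← markovMeasure_map_eq, integral_map hmeas.aemeasurable hF.aestronglyMeasurable]
    rfl
  rw [h2]
  rw [Measure.comp_eq_comp_const_apply] at h1 ⊢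
  have h3 := h1.integral_comp
  rw [Kernel.integral_comp h1]
  rw [Kernel.const_apply] at h3 ⊢
  have hG : StronglyMeasurable fun z => ∫ w : E × X, f w.2 ∂((skewKernel π T hT ^ n) z) :=
    hF.integral_kernel
  rw [integrable_map_measure hG.aestronglyMeasurable hpair.aemeasurable] at h3
  exact ⟨h3, integral_map hpair.aemeasurable hG.aestronglyMeasurable⟩

lemma integrable_expectationOp (hT : Measurable (fun p : E × X => T p.1 p.2))
    (hTμ : ∀ y, MeasurePreserving (T y) μ μ) {f : X → 𝕜} (hf : StronglyMeasurable f)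
    (hfi : Integrable f μ) (n : ℕ) :
    Integrable (expectationOp (markovMeasure π m) T n f) μ := by
  have hj : StronglyMeasurable fun q : X × (ℕ → E) => f (randomIterate T q.2 n q.1) :=
    hf.comp_measurable ((measurable_randomIterate hT n).comp measurable_swap)
  refine ⟨hj.integral_prod_right'.aestronglyMeasurable, ?_⟩
  refine lt_of_le_of_lt (lintegral_mono fun x => enorm_integral_le_lintegral_enorm _) ?_
  rw [lintegral_lintegral_randomIterate hT hTμ n hf.enorm]
  exact hfi.2

lemma cesaroMean_eq_integral_kernelAvg {f : X → 𝕜} (hf : StronglyMeasurable f) {x : X}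
    (hx : ∀ n : ℕ, Integrable (fun ω => f (randomIterate T ω n x)) (markovMeasure π m)) (n : ℕ) :
    cesaroMean (markovMeasure π m) T f n x
      = ∫ y, kernelAvg (skewKernel π T hT) (fun w => f w.2) n (y, x) ∂m := by
  simp only [cesaroMean, kernelAvg]
  rw [integral_const_mul, integral_finsetSum _ fun j _ =>
    (expectationOp_eq_integral_pow (hT := hT) hf (hx j)).1]
  congr 1
  exact Finset.sum_congr rfl fun j _ => (expectationOp_eq_integral_pow (hT := hT) hf (hx j)).2

end Expectation

end SkewChain

/-! ### Strict irreducibility -/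

/-- An integrable function on a product with vanishing integrals over all measurable rectangles
vanishes almost everywhere. -/
lemma ae_eq_zero_of_setIntegral_prod_eq_zero {α β 𝕜 : Type*} [MeasurableSpace α]
    [MeasurableSpace β] [RCLike 𝕜] {ρ : Measure (α × β)} {d : α × β → 𝕜} (hd : Integrable d ρ)
    (h : ∀ A : Set α, ∀ C : Set β, MeasurableSet A → MeasurableSet C →
      ∫ z in A ×ˢ C, d z ∂ρ = 0) : d =ᵐ[ρ] 0 := by
  have huniv : ∫ z, d z ∂ρ = 0 := by
    have := h Set.univ Set.univ .univ .univ
    rwa [Set.univ_prod_univ, setIntegral_univ] at this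
  have key : ∀ S : Set (α × β), MeasurableSet S → ∫ z in S, d z ∂ρ = 0 := by
    intro S hS
    induction S, hS using MeasurableSpace.induction_on_inter generateFrom_prod.symm
      isPiSystem_prod with
    | empty => simp
    | basic S hS =>
      obtain ⟨A, hA, C, hC, rfl⟩ := hS
      exact h A C hA hC
    | compl S hS ih =>
      have := integral_add_compl hS hd
      rwa [ih, huniv, zero_add] at this
    | iUnion S hdisj hS ih =>
      rw [integral_iUnion hS hdisj hd.integrableOn]
      simp [ih]
  exact hd.ae_eq_of_forall_setIntegral_eq d 0 (integrable_zero _ _ _) fun S hS _ => by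
    simpa using key S hS

section Irreducible

variable {E X 𝕜 : Type*} [MeasurableSpace E] [MeasurableSpace X] [RCLike 𝕜]
  {π : Kernel E E} [IsMarkovKernel π] {m : Measure E}
  {μ : Measure X} [IsProbabilityMeasure μ]
  {T : E → X → X} {hT : Measurable (fun p : E × X => T p.1 p.2)}

/-- If `h` is constant along the transitions of the chain on `E × X`, then from almost every `y`
the section `h (y', ·)` is the same for `π(y, ·)`-almost all `y'`: composed with `T_y`, all these
sections agree with `h (y, ·)`, and composition with a measure-preserving map is injective. -/
lemma ae_exists_section_ae_eq (hTμ : ∀ y, MeasurePreserving (T y) μ μ) {h : E × X → 𝕜}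
    (hm : StronglyMeasurable h)
    (hinv : ∀ᵐ z ∂(m.prod μ), ∀ᵐ w ∂(skewKernel π T hT z), h w = h z) :
    ∀ᵐ y ∂m, ∃ y₀, ∀ᵐ y' ∂(π y), (fun x => h (y', x)) =ᵐ[μ] fun x => h (y₀, x) := by
  filter_upwards [Measure.ae_ae_of_ae_prod hinv] with y hy
  have h1 : ∀ᵐ x ∂μ, ∀ᵐ y' ∂(π y), h (y', T y x) = h (y, x) := by
    filter_upwards [hy] with x hx
    exact (ae_skewKernel_iff (hm.measurable (measurableSet_singleton _)) (y, x)).1 hx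
  have hTy : Measurable (T y) := (hTμ y).measurable
  have hset : MeasurableSet {p : X × E | h (p.2, T y p.1) = h (y, p.1)} :=
    measurableSet_eq_fun
      (hm.measurable.comp (measurable_snd.prodMk (hTy.comp measurable_fst)))
      (hm.measurable.comp (measurable_const.prodMk measurable_fst))
  have h2 : ∀ᵐ y' ∂(π y), ∀ᵐ x ∂μ, h (y', T y x) = h (y, x) :=
    (Measure.ae_ae_comm (p := fun x y' => h (y', T y x) = h (y, x)) hset).1 h1
  obtain ⟨y₀, hy₀⟩ := h2.exists
  refine ⟨y₀, ?_⟩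
  filter_upwards [h2] with y' hy'
  have hs : MeasurableSet {x | h (y', x) = h (y₀, x)} :=
    measurableSet_eq_fun (hm.measurable.comp measurable_prodMk_left)
      (hm.measurable.comp measurable_prodMk_left)
  have h3 : ∀ᵐ x ∂(μ.map (T y)), h (y', x) = h (y₀, x) := by
    rw [ae_map_iff hTy.aemeasurable hs]
    filter_upwards [hy', hy₀] with x a b
    rw [a, b]
  rwa [(hTμ y).map_eq] at h3

variable [IsProbabilityMeasure m]

/-- Under strict irreducibility, a measurable function that is almost surely constant under
`π(y, ·)` for almost every `y` is almost surely constant. -/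
lemma StrictlyIrreducible.exists_ae_eq_const (hπ : StrictlyIrreducible π m) {ψ : E → 𝕜}
    (hψ : Measurable ψ) (h : ∀ᵐ y ∂m, ∃ c, ∀ᵐ y' ∂(π y), ψ y' = c) : ∃ c, ∀ᵐ y ∂m, ψ y = c := by
  refine exists_eventuallyEq_const_of_forall_separating MeasurableSet fun U hU => ?_
  have hB : MeasurableSet (ψ ⁻¹' U) := hψ hU
  have hdet : ∀ᵐ y ∂m, π y (ψ ⁻¹' U) = 0 ∨ π y (ψ ⁻¹' U) = 1 := by
    filter_upwards [h] with y ⟨c, hc⟩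
    by_cases hcU : c ∈ U
    · refine Or.inr ((mem_ae_iff_prob_eq_one hB).1 ?_)
      filter_upwards [hc] with y' hy'
      simpa [hy'] using hcU
    · refine Or.inl (measure_eq_zero_iff_ae_notMem.2 ?_)
      filter_upwards [hc] with y' hy'
      simpa [hy'] using hcU
  rcases hπ (ψ ⁻¹' U) hB hdet with h0 | h1
  · exact Or.inr (measure_eq_zero_iff_ae_notMem.1 h0)
  · exact Or.inl ((mem_ae_iff_prob_eq_one hB).2 h1)

/-- Under strict irreducibility, an integrable function that is constant along the transitions of
the chain on `E × X` depends on the second coordinate only. -/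
lemma StrictlyIrreducible.ae_eq_integral_fst (hπ : StrictlyIrreducible π m)
    (hTμ : ∀ y, MeasurePreserving (T y) μ μ) {h : E × X → 𝕜} (hm : StronglyMeasurable h)
    (hi : Integrable h (m.prod μ))
    (hinv : ∀ᵐ z ∂(m.prod μ), ∀ᵐ w ∂(skewKernel π T hT z), h w = h z) :
    ∀ᵐ z ∂(m.prod μ), h z = ∫ y, h (y, z.2) ∂m := by
  have hg : Integrable (fun x => ∫ y, h (y, x) ∂m) μ := hi.integral_prod_right
  have hg2 : Integrable (fun z : E × X => ∫ y, h (y, z.2) ∂m) (m.prod μ) :=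
    hg.comp_snd m
  have key := ae_eq_zero_of_setIntegral_prod_eq_zero (hi.sub hg2) fun A C hA hC => ?_
  · filter_upwards [key] with z hz
    simpa [sub_eq_zero] using hz
  have hψ : StronglyMeasurable fun y => ∫ x in C, h (y, x) ∂μ := hm.integral_prod_right'
  obtain ⟨c, hc⟩ := hπ.exists_ae_eq_const hψ.measurable (by
    filter_upwards [ae_exists_section_ae_eq hTμ hm hinv] with y ⟨y₀, hy₀⟩
    refine ⟨∫ x in C, h (y₀, x) ∂μ, ?_⟩
    filter_upwards [hy₀] with y' hy'
    exact integral_congr_ae (ae_restrict_of_ae hy'))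
  -- Both `h` and its fibre mean have integral `m(A) c` over `A × C`.
  have hrect : ∫ z in A ×ˢ C, h z ∂(m.prod μ) = m.real A • c := by
    rw [setIntegral_prod _ hi.integrableOn, integral_congr_ae (ae_restrict_of_ae hc)]
    simp
  have hgC : ∫ x in C, ∫ y, h (y, x) ∂m ∂μ = c := by
    have hsw : Integrable (Function.uncurry fun y x => h (y, x)) (m.prod (μ.restrict C)) := by
      refine Integrable.mono_measure hi ?_
      exact Measure.prod_mono le_rfl Measure.restrict_le_self
    rw [← integral_integral_swap hsw, integral_congr_ae hc]
    simp
  have hrect2 : ∫ z in A ×ˢ C, ∫ y, h (y, z.2) ∂m ∂(m.prod μ) = m.real A • c := by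
    rw [setIntegral_prod _ hg2.integrableOn]
    simp [hgC]
  simp only [Pi.sub_apply]
  rw [integral_sub hi.integrableOn hg2.integrableOn, hrect, hrect2, sub_self]

/-- Under strict irreducibility, the limit function is the conditional expectation given the
almost everywhere invariant sets. -/
lemma StrictlyIrreducible.integral_fst_ae_eq_condExp (hπ : StrictlyIrreducible π m)
    (hmπ : Kernel.Invariant π m) (hTμ : ∀ y, MeasurePreserving (T y) μ μ) {f : X → 𝕜}
    (hfi : Integrable f μ)
    {h : E × X → 𝕜} (hm : StronglyMeasurable h) (hi : Integrable h (m.prod μ))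
    (hinv : ∀ᵐ z ∂(m.prod μ), ∀ᵐ w ∂(skewKernel π T hT z), h w = h z)
    (hset : ∀ A : Set (E × X), MeasurableSet A →
      (∀ᵐ z ∂(m.prod μ), ∀ᵐ w ∂(skewKernel π T hT z), w ∈ A ↔ z ∈ A) →
        ∫ z in A, h z ∂(m.prod μ) = ∫ z in A, f z.2 ∂(m.prod μ)) :
    (fun x => ∫ y, h (y, x) ∂m) =ᵐ[μ] μ[f | invariantSigma T m μ] := by
  set g : X → 𝕜 := fun x => ∫ y, h (y, x) ∂m with hg
  have hgm : StronglyMeasurable g :=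
    (hm.comp_measurable measurable_swap).integral_prod_right'
  have hgi : Integrable g μ := hi.integral_prod_right
  have hhg : ∀ᵐ z ∂(m.prod μ), h z = g z.2 := hπ.ae_eq_integral_fst hTμ hm hi hinv
  have hle : invariantSigma T m μ ≤ ‹MeasurableSpace X› := fun A hA => hA.1
  -- Two consecutive states of the chain have the same value of `h`, hence of `g`.
  have hgT : ∀ᵐ y ∂m, ∀ᵐ x ∂μ, g (T y x) = g x := by
    refine Measure.ae_ae_of_ae_prod (p := fun z : E × X => g (T z.1 z.2) = g z.2) ?_
    have hstep : ∀ᵐ z ∂(m.prod μ), ∀ᵐ w ∂(skewKernel π T hT z), h w = g w.2 := by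
      simpa using ae_ae_pow (invariant_skewKernel hmπ hTμ) 1 hhg
    filter_upwards [hhg, hinv, hstep] with z h1 h2 h3
    have hs : MeasurableSet {w : E × X | g w.2 = g z.2} :=
      (hgm.measurable.comp measurable_snd) (measurableSet_singleton _)
    have h4 : ∀ᵐ w ∂(skewKernel π T hT z), g w.2 = g z.2 := by
      filter_upwards [h2, h3] with w a b
      rw [← b, a, h1]
    exact ((ae_skewKernel_iff hs z).1 h4).exists.choose_spec
  have hgS : Measurable[invariantSigma T m μ] g := by
    intro U hU
    refine ⟨hgm.measurable hU, ?_⟩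
    filter_upwards [hgT] with y hy
    filter_upwards [hy] with x hx
    exact congrArg (· ∈ U) hx |>.to_iff |> propext
  refine ae_eq_condExp_of_forall_setIntegral_eq hle hfi (fun A _ _ => hgi.integrableOn)
    (fun A hA _ => ?_) hgS.stronglyMeasurable.aestronglyMeasurable
  have hA' : MeasurableSet (Set.univ ×ˢ A : Set (E × X)) := MeasurableSet.univ.prod hA.1
  have h1 := hset (Set.univ ×ˢ A) hA' ?_
  · have h2 : ∫ z in Set.univ ×ˢ A, h z ∂(m.prod μ) = ∫ x in A, g x ∂μ := by
      rw [integral_congr_ae (ae_restrict_of_ae hhg),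
        setIntegral_prod _ (hgi.comp_snd m).integrableOn]
      simp
    have h3 : ∫ z in Set.univ ×ˢ A, f z.2 ∂(m.prod μ) = ∫ x in A, f x ∂μ := by
      rw [setIntegral_prod _ (hfi.comp_snd m).integrableOn]
      simp
    rw [← h2, ← h3, h1]
  · have hAset : MeasurableSet {z : E × X | T z.1 z.2 ∈ A ↔ z.2 ∈ A} :=
      MeasurableSet.iff (hT hA.1) (measurable_snd hA.1)
    have h4 : ∀ᵐ z ∂(m.prod μ), T z.1 z.2 ∈ A ↔ z.2 ∈ A := by
      rw [Measure.ae_prod_iff_ae_ae hAset]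
      filter_upwards [hA.2] with y hy
      filter_upwards [hy] with x hx
      exact Eq.to_iff hx
    filter_upwards [h4] with z hz
    refine (ae_skewKernel_iff (p := fun w => w ∈ Set.univ ×ˢ A ↔ z ∈ Set.univ ×ˢ A)
      (hA'.iff (MeasurableSet.const _)) z).2 (ae_of_all _ fun y' => ?_)
    simpa using hz

end Irreducible

/-! ### Convergence of the Cesàro means -/

lemma MemLLogL.congr {X 𝕜 : Type*} [MeasurableSpace X] [RCLike 𝕜] {μ : Measure X}
    {f f' : X → 𝕜} (h : MemLLogL f μ) (hff' : f =ᵐ[μ] f') :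
    MemLLogL f' μ := by
  refine ⟨h.1.congr hff', lt_of_eq_of_lt (lintegral_congr_ae ?_) h.2⟩
  filter_upwards [hff'] with x hx
  rw [hx]

section Limit

variable {E X 𝕜 : Type*} [MeasurableSpace E] [MeasurableSpace X] [RCLike 𝕜]
  {π : Kernel E E} [IsMarkovKernel π] {m : Measure E} [IsProbabilityMeasure m]
  {μ : Measure X} [IsProbabilityMeasure μ]
  {T : E → X → X} {hT : Measurable (fun p : E × X => T p.1 p.2)}

lemma tendsto_eLpNorm_cesaroMean (hTμ : ∀ y, MeasurePreserving (T y) μ μ)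
    {f : X → 𝕜} (hf : StronglyMeasurable f) (hfi : Integrable f μ)
    {h : E × X → 𝕜} (hm : StronglyMeasurable h) (hi : Integrable h (m.prod μ))
    (hlim : Tendsto (fun n => eLpNorm (kernelAvg (skewKernel π T hT) (fun w => f w.2) n - h) 1
      (m.prod μ)) atTop (𝓝 0)) :
    Tendsto (fun n => eLpNorm (fun x => cesaroMean (markovMeasure π m) T f n x
      - ∫ y, h (y, x) ∂m) 1 μ) atTop (𝓝 0) := by
  refine tendsto_of_tendsto_of_tendsto_of_le_of_le tendsto_const_nhds hlim
    (fun _ => zero_le) fun n => ?_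
  have hF : StronglyMeasurable fun w : E × X => f w.2 := hf.comp_measurable measurable_snd
  have hA : StronglyMeasurable (kernelAvg (skewKernel π T hT) (fun w => f w.2) n) :=
    stronglyMeasurable_kernelAvg hF n
  have hAm : Measurable fun z : E × X =>
      ‖(kernelAvg (skewKernel π T hT) (fun w => f w.2) n - h) z‖ₑ := (hA.sub hm).enorm
  rw [eLpNorm_one_eq_lintegral_enorm, eLpNorm_one_eq_lintegral_enorm,
    lintegral_prod_symm' _ hAm]
  refine lintegral_mono_ae ?_
  filter_upwards [ae_integrable_randomIterate (π := π) (m := m) hT hTμ hf hfi,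
    hi.prod_left_ae] with x hx hhx
  have hAi : Integrable (fun y => kernelAvg (skewKernel π T hT) (fun w => f w.2) n (y, x)) m := by
    simp only [kernelAvg]
    exact (integrable_finsetSum _ fun j _ =>
      (expectationOp_eq_integral_pow (hT := hT) hf (hx j)).1).const_mul _
  rw [cesaroMean_eq_integral_kernelAvg (hT := hT) hf hx, ← integral_sub hAi hhx]
  exact enorm_integral_le_lintegral_enorm _

/-- Almost everywhere convergence of the Cesàro means for functions in `L log L`: the maximal
function on `E × X` is integrable, so it dominates the averages along almost every fibre
`E × {x}`. -/
lemma ae_tendsto_cesaroMean (hmπ : Kernel.Invariant π m) (hTμ : ∀ y, MeasurePreserving (T y) μ μ)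
    {f : X → 𝕜} (hf : StronglyMeasurable f) (hfi : Integrable f μ) (hlog : MemLLogL f μ)
    {h : E × X → 𝕜} (hm : StronglyMeasurable h)
    (hlim : ∀ᵐ z ∂(m.prod μ), Tendsto
      (fun n => kernelAvg (skewKernel π T hT) (fun w => f w.2) n z) atTop (𝓝 (h z))) :
    ∀ᵐ x ∂μ, Tendsto (fun n => cesaroMean (markovMeasure π m) T f n x) atTop
      (𝓝 (∫ y, h (y, x) ∂m)) := by
  have hF : StronglyMeasurable fun w : E × X => f w.2 := hf.comp_measurable measurable_snd
  have hA (n : ℕ) : StronglyMeasurable (kernelAvg (skewKernel π T hT) (fun w => f w.2) n) :=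
    stronglyMeasurable_kernelAvg hF n
  have hsnd : MeasurePreserving (Prod.snd : E × X → X) (m.prod μ) μ := measurePreserving_snd
  have hM : Measurable (kernelMax (skewKernel π T hT) fun w => ‖f w.2‖ₑ) :=
    measurable_kernelMax hF.enorm
  have hMfin : ∫⁻ z, kernelMax (skewKernel π T hT) (fun w => ‖f w.2‖ₑ) z ∂(m.prod μ) < ∞ := by
    have h1 := lintegral_kernelMax_lt_top (ρ := m.prod μ) (invariant_skewKernel (hT := hT) hmπ hTμ)
      (g := fun w => ‖f w.2‖) hF.norm.measurable (fun w => norm_nonneg _) ?_ ?_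
    · simpa only [ofReal_norm] using h1
    · simp only [ofReal_norm]
      rw [hsnd.lintegral_comp hf.enorm]
      exact hfi.2
    · have hg : Measurable fun x => ENNReal.ofReal (‖f x‖ * Real.posLog ‖f x‖) := by
        have := hf.norm.measurable
        unfold Real.posLog
        fun_prop
      exact lt_of_eq_of_lt (hsnd.lintegral_comp hg) hlog.2
  have hset : MeasurableSet {z : E × X | Tendsto
      (fun n => kernelAvg (skewKernel π T hT) (fun w => f w.2) n z) atTop (𝓝 (h z))} :=
    measurableSet_tendsto_fun (fun n => (hA n).measurable) hm.measurable
  have hlim' : ∀ᵐ x ∂μ, ∀ᵐ y ∂m, Tendsto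
      (fun n => kernelAvg (skewKernel π T hT) (fun w => f w.2) n (y, x)) atTop (𝓝 (h (y, x))) :=
    (Measure.ae_ae_comm (p := fun y x => Tendsto
      (fun n => kernelAvg (skewKernel π T hT) (fun w => f w.2) n (y, x)) atTop
      (𝓝 (h (y, x)))) hset).1 (Measure.ae_ae_of_ae_prod hlim)
  rw [lintegral_prod_symm' _ hM] at hMfin
  filter_upwards [hlim', ae_lt_top hM.lintegral_prod_left' hMfin.ne,
    ae_integrable_randomIterate (π := π) (m := m) hT hTμ hf hfi] with x h1 h2 h3
  simp only [cesaroMean_eq_integral_kernelAvg (hT := hT) hf h3]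
  have hMx : Measurable fun y => kernelMax (skewKernel π T hT) (fun w => ‖f w.2‖ₑ) (y, x) :=
    hM.comp measurable_prodMk_right
  refine tendsto_integral_of_dominated_convergence
    (fun y => (kernelMax (skewKernel π T hT) (fun w => ‖f w.2‖ₑ) (y, x)).toReal)
    (fun n => ((hA n).comp_measurable measurable_prodMk_right).aestronglyMeasurable)
    (integrable_toReal_of_lintegral_ne_top hMx.aemeasurable h2.ne) (fun n => ?_) h1
  filter_upwards [ae_lt_top hMx h2.ne] with y hy
  rw [← toReal_enorm]
  exact ENNReal.toReal_mono hy.ne (enorm_kernelAvg_le_kernelMax _ n (y, x))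

end Limit

end RandomErgodic

open RandomErgodic in
theorem mainTheorem4 {E X 𝕜 : Type*} [MeasurableSpace E] [MeasurableSpace X] [RCLike 𝕜]
    (π : Kernel E E) [IsMarkovKernel π] (m : Measure E) [IsProbabilityMeasure m]
    (hm : Kernel.Invariant π m)
    (μ : Measure X) [IsProbabilityMeasure μ]
    (T : E → X → X) (hT : Measurable (fun p : E × X => T p.1 p.2))
    (hTμ : ∀ y, MeasurePreserving (T y) μ μ)
    (f : X → 𝕜) (hf : Integrable f μ) :
    (∀ j : ℕ,
      (∀ᵐ x ∂μ, Integrable (fun ω => f (RandomErgodic.randomIterate T ω j x))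
        (RandomErgodic.markovMeasure π m)) ∧
      Integrable (RandomErgodic.expectationOp (RandomErgodic.markovMeasure π m) T j f) μ) ∧
    ∃ g : X → 𝕜, Integrable g μ ∧
      Tendsto (fun n : ℕ => eLpNorm (fun x =>
        RandomErgodic.cesaroMean (RandomErgodic.markovMeasure π m) T f n x - g x) 1 μ)
        atTop (𝓝 0) ∧
      (RandomErgodic.MemLLogL f μ →
        ∀ᵐ x ∂μ, Tendsto (fun n : ℕ =>
          RandomErgodic.cesaroMean (RandomErgodic.markovMeasure π m) T f n x)
          atTop (𝓝 (g x))) ∧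
      (RandomErgodic.StrictlyIrreducible π m →
        g =ᵐ[μ] μ[f | RandomErgodic.invariantSigma T m μ]) := by
  -- `f` is replaced by a strongly measurable representative, which changes neither its values
  -- along almost every random orbit nor its expectation operators almost everywhere.
  obtain ⟨f', hf'm, hff'⟩ := hf.1
  have hf' : Integrable f' μ := hf.congr hff'
  have horbit := ae_ae_randomIterate (π := π) (m := m) hT hTμ hff'
  have hexp : ∀ᵐ x ∂μ, ∀ j, expectationOp (markovMeasure π m) T j f x
      = expectationOp (markovMeasure π m) T j f' x := by
    filter_upwards [horbit] with x hx j
    exact integral_congr_ae (hx j)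
  have hces : ∀ᵐ x ∂μ, ∀ n, cesaroMean (markovMeasure π m) T f n x
      = cesaroMean (markovMeasure π m) T f' n x := by
    filter_upwards [hexp] with x hx n
    simp only [cesaroMean, hx]
  refine ⟨fun j => ⟨?_, ?_⟩, ?_⟩
  · filter_upwards [horbit, ae_integrable_randomIterate (π := π) (m := m) hT hTμ hf'm hf']
      with x hx hx'
    exact (hx' j).congr (EventuallyEq.symm (hx j))
  · refine (integrable_expectationOp (π := π) (m := m) hT hTμ hf'm hf' j).congr ?_
    filter_upwards [hexp] with x hx
    exact (hx j).symm
  have hQ : Kernel.Invariant (skewKernel π T hT) (m.prod μ) := invariant_skewKernel hm hTμ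
  obtain ⟨h, hhm, hhi, hinv, hL1, hae, hset⟩ := exists_kernelAvg_tendsto hQ
    (hf'm.comp_measurable measurable_snd) (hf'.comp_snd m)
  refine ⟨fun x => ∫ y, h (y, x) ∂m, hhi.integral_prod_right, ?_, fun hlog => ?_, fun hirr => ?_⟩
  · refine (tendsto_eLpNorm_cesaroMean hTμ hf'm hf' hhm hhi hL1).congr fun n => ?_
    refine eLpNorm_congr_ae ?_
    filter_upwards [hces] with x hx
    rw [hx n]
  · filter_upwards [hces, ae_tendsto_cesaroMean hm hTμ hf'm hf' (hlog.congr hff') hhm hae]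
      with x hx hx'
    simpa only [hx] using hx'
  · exact (hirr.integral_fst_ae_eq_condExp hm hTμ hf' hhm hhi hinv hset).trans
      (condExp_congr_ae hff'.symm)
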